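/- **Setting.** Let $A$ be a finite non-empty set of options, $N=|A|$. A *Llull matrix* assigns to each ordered pair of different options a number $v_{xy}\in[0,1]$ with $v_{xy}+v_{yx}\le1$; it is *complete* if always $v_{xy}+v_{yx}=1$. There are finitely many voters $i$ with weights $w_i>0$, $\sum_iw_i=1$ (for instance all equal); the vote of $i$ is a Llull matrix $u^i$, and the Llull matrix of the votes is $v=\sum_iw_iu^i$. A vote $u$ is a *ranking* (possibly truncated or with ties) if there is an ordered list with ties of some (possibly none or all) of the options such that, for $x\ne y$: $u_{xy}=1$, $u_{yx}=0$ if $x$ is listed and $y$ is listed below $x$ or not listed; $u_{xy}=u_{yx}=\frac12$ if both are listed and tied; $u_{xy}=u_{yx}=0$ if neither is listed. Restricting the votes to $X\subseteq A$ means keeping only the entries $u^i_{xy}$ with $x,y\in X$. **CLC projection.** For $x\ne y$ let $v^*_{xy}$ be the maximum, over all paths $x=x_0,x_1,\dots,x_n=y$ in $A$, of $\min_{0\le j<n}v_{x_jx_{j+1}}$, and let $m^*_{xy}=v^*_{xy}-v^*_{yx}$ and $t_{xy}=v_{xy}+v_{yx}$. Take an *admissible order*, i.e. a total order $\prec$ on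 $A$ such that $m^*_{xy}\ge0$ whenever $x\prec y$; let $x'$ be the immediate successor of $x$. Put $m^\sigma_{xx'}=\min\{m^*_{pq}: p\preceq x,\ x'\preceq q\}$, and let $(t^\sigma_{xy})$ be the minimizer of $\sum_x\sum_{y\ne x}(\tau_{xy}-t_{xy})^2$ among all symmetric $(\tau_{xy})$ with $m^\sigma_{xx'}\le\tau_{xx'}\le1$ and $0\le\tau_{xz}-\tau_{x'z}\le m^\sigma_{xx'}$ for all consecutive $x,x'$ and all $z\notin\{x,x'\}$. Let $\gamma_{xx'}=\big[\tfrac12(t^\sigma_{xx'}-m^\sigma_{xx'}),\tfrac12(t^\sigma_{xx'}+m^\sigma_{xx'})\big]$. For $x\prec y$ the projected scores $\pi_{xy}$ and $\pi_{yx}$ are the maximum and the minimum of $\bigcup_{x\preceq p\prec y}\gamma_{pp'}$. **Fraction-like rates.** Let $\Phi=\{\varphi\in\mathbb R^A:\varphi_x>0\ \text{for all }x,\ \sum_x\varphi_x=1\}$ and $$F(\varphi)=\prod_{\{x,y\},\,x\neq y}\frac{\varphi_x^{\pi_{xy}}\varphi_y^{\pi_{yx}}}{(\varphi_x+\varphi_y)^{\pi_{xy}+\pi_{yx}}}.$$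 The *fraction-like rates* of $v$ are the vector $\varphi\in\mathbb R^A$ to which every maximizing sequence converges, i.e. every sequence $\varphi^n\in\Phi$ with $F(\varphi^n)\to\sup_\Phi F$ (Zermelo's strengths of the CLC projection $\pi$ of $v$). **Theorem.** Assume that $N=1$ or that $v_{xy}\neq0$ for some $x\ne y$. Then the fraction-like rates $\varphi$ of $v$ exist and are unique: exactly one vector arises as such a limit when the admissible order is allowed to be any one. Call a non-empty set $X\subseteq A$ *unanimously preferred* if $v_{xy}=1$ for all $x\in X$ and $y\in A\setminus X$ (so $A$ itself is unanimously preferred), and *minimal* if moreover no proper subset of it is unanimously preferred. * (H1) If $X$ is unanimously preferred, then $\varphi_y=0$ for all $y\notin X$. * (H2) Assume that all votes are complete, or that all votes are rankings and $X\ne A$. If $X$ is minimal unanimously preferred, then $\varphi_x>0$ for all $x\in X$, and $(\varphi_x)_{x\in X}$ are the fraction-like rates of the Llull matrix of the votes restricted to $X$. * (H3) Assume that all votes are complete. If $X\subseteq A$ is non-empty, $\varphi_x>0$ for all $x\in X$, and $(\varphi_x)_{x\in X}$ are the fraction-like rates of the Llull matrix of the votes restricted to $X$, then $X$ is minimal unanimously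 preferred. -/

import Mathlib

open Filter Topology


noncomputable section

namespace FractionRates

variable {A : Type*}

/-- A Llull matrix (matrix of preference scores) on the options `A`. Only the entries at pairs of
different options matter, here and in all the definitions below. -/
def IsLlull (v : A → A → ℝ) : Prop :=
  ∀ x y, x ≠ y → 0 ≤ v x y ∧ v x y ≤ 1 ∧ v x y + v y x ≤ 1

/-- Completeness of a vote, as a matrix of preference scores. -/
def IsCompleteVote (v : A → A → ℝ) : Prop :=
  ∀ x y, x ≠ y → v x y + v y x = 1

/-- The vote `u` is a ranking, possibly truncated and possibly with ties. Here `r x` is the place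
of `x` in the ranking, smaller meaning better, and `r x = ⊤` means that `x` is not mentioned.
A mentioned option is preferred to every option that is placed later or not mentioned, mentioned
options placed equally are tied (half a vote each way), and two options that are not mentioned
are not compared with each other (both scores vanish). -/
def IsRanking (u : A → A → ℝ) : Prop :=
  ∃ r : A → ℕ∞, ∀ x y, x ≠ y →
    (r x < r y → u x y = 1) ∧
    (r y < r x → u x y = 0) ∧
    (r x = r y → r x ≠ ⊤ → u x y = 1 / 2) ∧
    (r x = ⊤ → r y = ⊤ → u x y = 0)

/-- The Llull matrix of the votes `u i`, where voter `i` has weight `w i`. -/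
def llull {ι : Type*} [Fintype ι] (w : ι → ℝ) (u : ι → A → A → ℝ) (x y : A) : ℝ :=
  ∑ i, w i * u i x y

/-- Restriction of every individual vote to the options in `X`. -/
def restrictVotes {ι : Type*} (u : ι → A → A → ℝ) (X : Finset A) :
    ι → {x // x ∈ X} → {x // x ∈ X} → ℝ :=
  fun i x y => u i x y

/-- Every member of `X` is unanimously preferred to every option outside `X`. -/
def UnanimouslyPreferred (v : A → A → ℝ) (X : Finset A) : Prop :=
  ∀ x ∈ X, ∀ y, y ∉ X → v x y = 1

/-- `X` is a non-empty unanimously preferred set and no proper subset of it is one. -/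
def IsMinimalPreferred (v : A → A → ℝ) (X : Finset A) : Prop :=
  Minimal (fun Y : Finset A => Y.Nonempty ∧ UnanimouslyPreferred v Y) X

/-- The turnout of a pair of options. -/
def turnout (v : A → A → ℝ) (x y : A) : ℝ := v x y + v y x

/-! ### The CLC projection -/

/-- The score of the weakest link of the path `p 0, p 1, …, p (n + 1)`. -/
def pathScore (v : A → A → ℝ) {n : ℕ} (p : Fin (n + 2) → A) : ℝ :=
  ⨅ i : Fin (n + 1), v (p i.castSucc) (p i.succ)

/-- The indirect score: the maximum, over the paths from `x` to `y`, of the score of the weakest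
link. It is used at pairs `x ≠ y` only. -/
def indirectScore (v : A → A → ℝ) (x y : A) : ℝ :=
  sSup {s | ∃ (n : ℕ) (p : Fin (n + 2) → A), p 0 = x ∧ p (Fin.last (n + 1)) = y ∧
    (∀ i : Fin (n + 1), p i.castSucc ≠ p i.succ) ∧ s = pathScore v p}

/-- The indirect margin. -/
def indirectMargin (v : A → A → ℝ) (x y : A) : ℝ :=
  indirectScore v x y - indirectScore v y x

variable [Fintype A]

/-- Total orders on `A` are given by the position `ξ x` of every option; `ξ` is admissible for `v`
if the indirect margin of `x` over `y` is non-negative whenever `x` precedes `y`. -/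
def IsAdmissible (v : A → A → ℝ) (ξ : A ≃ Fin (Fintype.card A)) : Prop :=
  ∀ x y, ξ x < ξ y → 0 ≤ indirectMargin v x y

/-- `x'` immediately follows `x` in the order `ξ`. -/
def Next (ξ : A ≃ Fin (Fintype.card A)) (x x' : A) : Prop :=
  (ξ x : ℕ) + 1 = (ξ x' : ℕ)

/-- The intermediate projected margin of two options `x`, `x'`, where `x` precedes `x'`: the
minimum of the indirect margins of `p` over `q`, where `p` is `x` or precedes it, and `q` is `x'`
or comes after it. -/
def projMargin (v : A → A → ℝ) (ξ : A ≃ Fin (Fintype.card A)) (x x' : A) : ℝ :=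
  sInf {m | ∃ p q, ξ p ≤ ξ x ∧ ξ x' ≤ ξ q ∧ m = indirectMargin v p q}

/-- The constraints on the intermediate projected turnouts. -/
def IsFeasible (v : A → A → ℝ) (ξ : A ≃ Fin (Fintype.card A)) (τ : A → A → ℝ) : Prop :=
  (∀ x y, τ x y = τ y x) ∧
  ∀ x x', Next ξ x x' →
    projMargin v ξ x x' ≤ τ x x' ∧ τ x x' ≤ 1 ∧
    ∀ z, z ≠ x → z ≠ x' → 0 ≤ τ x z - τ x' z ∧ τ x z - τ x' z ≤ projMargin v ξ x x'

/-- The squared Euclidean distance of `τ` to the turnouts of `v`. -/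
def deviation [DecidableEq A] (v τ : A → A → ℝ) : ℝ :=
  ∑ x, ∑ y ∈ Finset.univ.erase x, (τ x y - turnout v x y) ^ 2

/-- `τ` is the system of intermediate projected turnouts: the point that satisfies the constraints
and is closest to the turnouts of `v`. -/
def IsProjTurnout [DecidableEq A] (v : A → A → ℝ) (ξ : A ≃ Fin (Fintype.card A))
    (τ : A → A → ℝ) : Prop :=
  IsFeasible v ξ τ ∧ ∀ τ', IsFeasible v ξ τ' → deviation v τ ≤ deviation v τ'

/-- For `x` preceding `y`, the union of the intervals
`[(τ p p' - m p p') / 2, (τ p p' + m p p') / 2]` over the consecutive pairs `p`, `p'` that lie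
between `x` and `y`, both included, where `m` is the intermediate projected margin. -/
def scoreInterval (v : A → A → ℝ) (ξ : A ≃ Fin (Fintype.card A)) (τ : A → A → ℝ) (x y : A) :
    Set ℝ :=
  {s | ∃ p p', Next ξ p p' ∧ ξ x ≤ ξ p ∧ ξ p' ≤ ξ y ∧
    s ∈ Set.Icc ((τ p p' - projMargin v ξ p p') / 2) ((τ p p' + projMargin v ξ p p') / 2)}

/-- `π` is the CLC projection of `v`. -/
def IsCLCProjection [DecidableEq A] (v π : A → A → ℝ) : Prop :=
  ∃ ξ : A ≃ Fin (Fintype.card A), IsAdmissible v ξ ∧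
    ∃ τ, IsProjTurnout v ξ τ ∧ ∀ x y, ξ x < ξ y →
      IsGreatest (scoreInterval v ξ τ x y) (π x y) ∧ IsLeast (scoreInterval v ξ τ x y) (π y x)

/-! ### Zermelo's method of strengths -/

/-- The open simplex of positive strengths that add up to one. -/
def openSimplex (A : Type*) [Fintype A] : Set (A → ℝ) :=
  {φ | (∀ x, 0 < φ x) ∧ ∑ x, φ x = 1}

/-- Zermelo's likelihood function. Grouping the factors of `(x, y)` and `(y, x)`, it is the product
over the unordered pairs of `φ x ^ v x y * φ y ^ v y x / (φ x + φ y) ^ (v x y + v y x)`. -/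
def likelihood [DecidableEq A] (v : A → A → ℝ) (φ : A → ℝ) : ℝ :=
  ∏ x, ∏ y ∈ Finset.univ.erase x, (φ x / (φ x + φ y)) ^ v x y

/-- A maximizing sequence of the likelihood function on the open simplex. -/
def IsMaximizingSeq [DecidableEq A] (v : A → A → ℝ) (φ : ℕ → A → ℝ) : Prop :=
  (∀ n, φ n ∈ openSimplex A) ∧
  Tendsto (fun n => likelihood v (φ n)) atTop (𝓝 (sSup (likelihood v '' openSimplex A)))

/-- `φ` is the vector of strengths of `v`: every maximizing sequence converges to `φ`. -/
def IsStrengths [DecidableEq A] (v : A → A → ℝ) (φ : A → ℝ) : Prop :=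
  ∀ ψ : ℕ → A → ℝ, IsMaximizingSeq v ψ → Tendsto ψ atTop (𝓝 φ)

/-- `φ` is the vector of fraction-like rates of the Llull matrix `v`: the strengths of its
CLC projection. -/
def IsFractionRates [DecidableEq A] (v : A → A → ℝ) (φ : A → ℝ) : Prop :=
  ∃ π, IsCLCProjection v π ∧ IsStrengths π φ

end FractionRates

end

open FractionRates

namespace FractionRates

/-! Everything is read off from the chain of intervals between consecutive options in an admissible
order. The interval at a cut starts at zero exactly when the projected turnout equals the projected
margin. Let the top class be the options up to the first such cut. Two options of the top class have
positive projected scores both ways. An option of the top class has a positive score over any option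
outside it, and the opposite score is zero. Positivity here uses that consecutive intervals overlap
and that the first interval is not the point zero, unless all scores of the votes vanish.

For such a matrix (`exists_isStrengths_of_dominant`) the likelihood splits into a block inside the
top class, a cross block and a block outside. Shrinking the outside strengths sends the cross block
to one without changing the other two. A maximizing sequence therefore loses all its mass outside
and is maximizing inside, where all exponents are positive: there compactness gives a maximizer and
strict log-concavity makes it unique.

Independence of the order (`IsCLCProjection.unique`): two admissible orders can differ only across
cuts of margin zero. There the constraints force equal turnouts, so the feasible set, its closest
point and the resulting scores coincide.

For a unanimously preferred proper subset, the cut behind it has margin one, hence interval [0,1],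
so the top class lies inside the set; this is (H1). If moreover every pair meeting the set has full
turnout, the projected turnouts of consecutive options inside it are one. A vanishing lower end
inside the set would then mean margin one and produce a smaller preferred set, so a minimal set
equals the top class (`IsMinimalPreferred.eq_topClass`). The projection also commutes with
restriction to it, which gives (H2). For (H3), rates sum to one both on the whole and on the subset,
and they are positive exactly on the minimal preferred set; comparing masses identifies the two
sets. -/

/-- The factor of the pair `(x, y)` in the likelihood function. -/
noncomputable def factor {A : Type*} [DecidableEq A] (v : A → A → ℝ) (φ : A → ℝ) (x y : A) : ℝ :=
  if x = y then 1 else (φ x / (φ x + φ y)) ^ v x y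

/-! ### Zermelo's likelihood: homogeneity, log-concavity, and strengths for positive scores -/

section Factor

variable {A : Type*} [DecidableEq A] {v : A → A → ℝ} {φ ψ : A → ℝ}

theorem factor_pos (hφ : ∀ x, 0 < φ x) (x y : A) : 0 < factor v φ x y := by
  unfold factor
  split_ifs with h
  · exact one_pos
  · have := hφ x
    have := hφ y
    positivity

theorem factor_le_one (hv : ∀ x y, x ≠ y → 0 ≤ v x y) (hφ : ∀ x, 0 < φ x) (x y : A) :
    factor v φ x y ≤ 1 := by
  unfold factor
  split_ifs with h
  · exact le_rfl
  · have h1 := hφ x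
    have h2 := hφ y
    refine Real.rpow_le_one (by positivity) ?_ (hv x y h)
    rw [div_le_one (by positivity)]
    linarith

theorem factor_smul {c : ℝ} (hc : 0 < c) (x y : A) :
    factor v (fun z => c * φ z) x y = factor v φ x y := by
  unfold factor
  rw [← mul_add, mul_div_mul_left _ _ hc.ne']

theorem factor_congr {v' : A → A → ℝ} {x y : A} (h : x ≠ y → v x y = v' x y) (hx : φ x = ψ x)
    (hy : φ y = ψ y) : factor v φ x y = factor v' ψ x y := by
  unfold factor
  split_ifs with hxy
  · rfl
  · rw [h hxy, hx, hy]

theorem tendsto_factor {κ : Type*} {l : Filter κ} {f : κ → A → ℝ} {x y : A}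
    (hx : Tendsto (fun n => f n x) l (𝓝 (φ x))) (hy : Tendsto (fun n => f n y) l (𝓝 (φ y)))
    (hne : φ x + φ y ≠ 0) (h : φ x ≠ 0 ∨ 0 < v x y) :
    Tendsto (fun n => factor v (f n) x y) l (𝓝 (factor v φ x y)) := by
  unfold factor
  split_ifs with hxy
  · exact tendsto_const_nhds
  · refine Tendsto.rpow_const (hx.div (hx.add hy) hne) ?_
    rcases h with h | h
    · exact Or.inl (div_ne_zero h hne)
    · exact Or.inr h.le

variable [Fintype A]

theorem likelihood_eq_prod_factor : likelihood v φ = ∏ x, ∏ y, factor v φ x y := by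
  unfold likelihood
  refine Finset.prod_congr rfl fun x _ => ?_
  rw [← Finset.mul_prod_erase Finset.univ _ (Finset.mem_univ x)]
  simp only [factor, if_true, one_mul]
  refine Finset.prod_congr rfl fun y hy => ?_
  rw [if_neg (Finset.ne_of_mem_erase hy).symm]

theorem likelihood_congr {v' : A → A → ℝ} (h : ∀ x y, x ≠ y → v x y = v' x y) :
    likelihood v = likelihood v' := by
  funext φ
  simp_rw [likelihood_eq_prod_factor]
  exact Finset.prod_congr rfl fun x _ => Finset.prod_congr rfl fun y _ =>
    factor_congr (h x y) rfl rfl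

theorem isStrengths_congr {v' : A → A → ℝ} (h : ∀ x y, x ≠ y → v x y = v' x y) :
    IsStrengths v φ ↔ IsStrengths v' φ := by
  simp only [IsStrengths, IsMaximizingSeq, likelihood_congr h]

theorem likelihood_pos (hφ : ∀ x, 0 < φ x) : 0 < likelihood v φ := by
  rw [likelihood_eq_prod_factor]
  exact Finset.prod_pos fun x _ => Finset.prod_pos fun y _ => factor_pos hφ x y

-- All factors lie in (0,1], so a product is controlled by any one of its factors. This turns
-- control of the likelihood into control of a single pair.
omit [Fintype A] in
theorem prod_factor_le_factor (hv : ∀ x y, x ≠ y → 0 ≤ v x y) (hφ : ∀ x, 0 < φ x)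
    {S T : Finset A} {x y : A} (hx : x ∈ S) (hy : y ∈ T) :
    ∏ x ∈ S, ∏ y ∈ T, factor v φ x y ≤ factor v φ x y := by
  have hnn := fun x y => (factor_pos (v := v) hφ x y).le
  have h1 := factor_le_one hv hφ
  have row : ∀ z, ∏ y ∈ T, factor v φ z y ≤ 1 := fun z =>
    Finset.prod_le_one (fun y _ => hnn z y) fun y _ => h1 z y
  rw [← Finset.mul_prod_erase S _ hx, ← Finset.mul_prod_erase T _ hy]
  refine (mul_le_of_le_one_right (mul_nonneg (hnn x y) (Finset.prod_nonneg fun _ _ => hnn _ _))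
    (Finset.prod_le_one (fun z _ => Finset.prod_nonneg fun _ _ => hnn _ _) fun z _ => row z)).trans
    (mul_le_of_le_one_right (hnn x y) (Finset.prod_le_one (fun _ _ => hnn _ _) fun _ _ => h1 _ _))

omit [Fintype A] in
theorem prod_factor_le_one (hv : ∀ x y, x ≠ y → 0 ≤ v x y) (hφ : ∀ x, 0 < φ x)
    (S T : Finset A) : ∏ x ∈ S, ∏ y ∈ T, factor v φ x y ≤ 1 :=
  Finset.prod_le_one (fun _ _ => Finset.prod_nonneg fun _ _ => (factor_pos hφ _ _).le) fun _ _ =>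
    Finset.prod_le_one (fun _ _ => (factor_pos hφ _ _).le) fun _ _ => factor_le_one hv hφ _ _

theorem likelihood_le_one (hv : ∀ x y, x ≠ y → 0 ≤ v x y) (hφ : ∀ x, 0 < φ x) :
    likelihood v φ ≤ 1 := by
  rw [likelihood_eq_prod_factor]
  exact prod_factor_le_one hv hφ _ _

theorem bddAbove_likelihood (hv : ∀ x y, x ≠ y → 0 ≤ v x y) :
    BddAbove (likelihood v '' openSimplex A) := by
  refine ⟨1, ?_⟩
  rintro _ ⟨φ, hφ, rfl⟩
  exact likelihood_le_one hv hφ.1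

/-- The positive vector `φ` scaled to have sum one. -/
noncomputable def normalized (φ : A → ℝ) (x : A) : ℝ := (∑ z, φ z)⁻¹ * φ x

omit [DecidableEq A] in
theorem normalized_mem [Nonempty A] (hφ : ∀ x, 0 < φ x) : normalized φ ∈ openSimplex A := by
  have hs : 0 < ∑ z, φ z := Finset.sum_pos (fun x _ => hφ x) Finset.univ_nonempty
  refine ⟨fun x => mul_pos (inv_pos.2 hs) (hφ x), ?_⟩
  unfold normalized
  rw [← Finset.mul_sum, inv_mul_cancel₀ hs.ne']

theorem likelihood_normalized [Nonempty A] (hφ : ∀ x, 0 < φ x) :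
    likelihood v (normalized φ) = likelihood v φ := by
  have hs : 0 < ∑ z, φ z := Finset.sum_pos (fun x _ => hφ x) Finset.univ_nonempty
  simp_rw [likelihood_eq_prod_factor]
  exact Finset.prod_congr rfl fun x _ => Finset.prod_congr rfl fun y _ =>
    factor_smul (inv_pos.2 hs) x y

omit [DecidableEq A] in
theorem openSimplex_nonempty [Nonempty A] : (openSimplex A).Nonempty :=
  ⟨_, normalized_mem fun _ => one_pos⟩

theorem likelihood_le_sSup [Nonempty A] (hv : ∀ x y, x ≠ y → 0 ≤ v x y) (hφ : ∀ x, 0 < φ x) :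
    likelihood v φ ≤ sSup (likelihood v '' openSimplex A) := by
  rw [← likelihood_normalized hφ]
  exact le_csSup (bddAbove_likelihood hv) ⟨_, normalized_mem hφ, rfl⟩

theorem sSup_likelihood_pos [Nonempty A] (hv : ∀ x y, x ≠ y → 0 ≤ v x y) :
    0 < sSup (likelihood v '' openSimplex A) :=
  (likelihood_pos fun _ => one_pos).trans_le (likelihood_le_sSup hv fun _ => one_pos)

theorem exists_isMaximizingSeq [Nonempty A] (hv : ∀ x y, x ≠ y → 0 ≤ v x y) :
    ∃ ψ, IsMaximizingSeq v ψ := by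
  obtain ⟨s, -, hs, hmem⟩ := exists_seq_tendsto_sSup
    ((openSimplex_nonempty (A := A)).image (likelihood v)) (bddAbove_likelihood hv)
  choose ψ hψ hψs using hmem
  refine ⟨ψ, hψ, ?_⟩
  simpa only [hψs] using hs

theorem IsStrengths.unique [Nonempty A] (hv : ∀ x y, x ≠ y → 0 ≤ v x y) (h : IsStrengths v φ)
    (h' : IsStrengths v ψ) : φ = ψ := by
  obtain ⟨s, hs⟩ := exists_isMaximizingSeq hv
  exact tendsto_nhds_unique (h s hs) (h' s hs)

theorem IsStrengths.sum_eq_one [Nonempty A] (hv : ∀ x y, x ≠ y → 0 ≤ v x y)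
    (h : IsStrengths v φ) : ∑ x, φ x = 1 := by
  obtain ⟨s, hs⟩ := exists_isMaximizingSeq hv
  have h1 : Tendsto (fun n => ∑ x, s n x) atTop (𝓝 (∑ x, φ x)) :=
    tendsto_finsetSum _ fun x _ => tendsto_pi_nhds.1 (h s hs) x
  simp_rw [fun n => (hs.1 n).2] at h1
  exact tendsto_nhds_unique h1 tendsto_const_nhds

omit [Fintype A] in
/-- The value of a factor at a geometric mean: log-concavity. -/
theorem factor_mul_factor_le (hv : ∀ x y, x ≠ y → 0 ≤ v x y) (hφ : ∀ x, 0 < φ x)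
    (hψ : ∀ x, 0 < ψ x) (x y : A) :
    factor v φ x y * factor v ψ x y ≤ factor v (fun z => √(φ z * ψ z)) x y ^ 2 := by
  unfold factor
  split_ifs with hxy
  · norm_num
  have a := hφ x
  have b := hφ y
  have c := hψ x
  have d := hψ y
  rw [← Real.mul_rpow (by positivity) (by positivity), ← Real.rpow_natCast, ← Real.rpow_mul
    (by positivity), mul_comm (v x y), Real.rpow_mul (by positivity), Real.rpow_natCast]
  refine Real.rpow_le_rpow (by positivity) ?_ (hv x y hxy)
  rw [div_mul_div_comm, div_pow, Real.sq_sqrt (by positivity)]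
  refine div_le_div_of_nonneg_left (by positivity) (by positivity) ?_
  have h1 := Real.sq_sqrt (mul_pos a c).le
  have h2 := Real.sq_sqrt (mul_pos b d).le
  have h3 : √(φ x * ψ x) * √(φ y * ψ y) = √(φ x * ψ y) * √(φ y * ψ x) := by
    rw [← Real.sqrt_mul (by positivity), ← Real.sqrt_mul (by positivity)]
    ring_nf
  have h4 := Real.sq_sqrt (mul_pos a d).le
  have h5 := Real.sq_sqrt (mul_pos b c).le
  -- The numerators agree, so only the denominators matter: (√(ac)+√(bd))² ≤ (a+b)(c+d), which is
  -- 2√(ad)√(bc) ≤ ad+bc.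
  nlinarith [sq_nonneg (√(φ x * ψ y) - √(φ y * ψ x))]

-- The Cauchy–Schwarz inequality for the denominators is strict unless the two vectors are
-- proportional on the pair.
omit [Fintype A] in
theorem factor_mul_factor_lt {x y : A} (hxy : x ≠ y) (hv : 0 < v x y) (hφ : ∀ x, 0 < φ x)
    (hψ : ∀ x, 0 < ψ x) (hne : φ x * ψ y ≠ φ y * ψ x) :
    factor v φ x y * factor v ψ x y < factor v (fun z => √(φ z * ψ z)) x y ^ 2 := by
  unfold factor
  rw [if_neg hxy, if_neg hxy, if_neg hxy]
  have a := hφ x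
  have b := hφ y
  have c := hψ x
  have d := hψ y
  rw [← Real.mul_rpow (by positivity) (by positivity), ← Real.rpow_natCast, ← Real.rpow_mul
    (by positivity), mul_comm (v x y), Real.rpow_mul (by positivity), Real.rpow_natCast]
  refine Real.rpow_lt_rpow (by positivity) ?_ hv
  rw [div_mul_div_comm, div_pow, Real.sq_sqrt (by positivity)]
  refine div_lt_div_of_pos_left (by positivity) (by positivity) ?_
  have h1 := Real.sq_sqrt (mul_pos a c).le
  have h2 := Real.sq_sqrt (mul_pos b d).le
  have h3 : √(φ x * ψ x) * √(φ y * ψ y) = √(φ x * ψ y) * √(φ y * ψ x) := by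
    rw [← Real.sqrt_mul (by positivity), ← Real.sqrt_mul (by positivity)]
    ring_nf
  have h4 := Real.sq_sqrt (mul_pos a d).le
  have h5 := Real.sq_sqrt (mul_pos b c).le
  have h6 : √(φ x * ψ y) - √(φ y * ψ x) ≠ 0 := by
    intro h
    rw [sub_eq_zero] at h
    exact hne (by rw [← h4, ← h5, h])
  nlinarith [sq_pos_of_ne_zero h6]

/-- The geometric mean of two non-proportional maximizers would beat both. It need not sum to one,
since the likelihood is homogeneous of degree zero. Proportional vectors of sum one are equal. -/
theorem maximizer_unique [Nonempty A] (hv : ∀ x y, x ≠ y → 0 < v x y) (hφ : φ ∈ openSimplex A)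
    (hψ : ψ ∈ openSimplex A)
    (h1 : likelihood v φ = sSup (likelihood v '' openSimplex A))
    (h2 : likelihood v ψ = sSup (likelihood v '' openSimplex A)) : φ = ψ := by
  have hv0 : ∀ x y, x ≠ y → 0 ≤ v x y := fun x y h => (hv x y h).le
  have hprop : ∀ x y, φ x * ψ y = φ y * ψ x := by
    by_contra! hne
    obtain ⟨x, y, hne⟩ := hne
    have hxy : x ≠ y := by
      rintro rfl
      exact hne rfl
    have hpos : ∀ x, 0 < √(φ x * ψ x) := fun x => Real.sqrt_pos.2 (mul_pos (hφ.1 x) (hψ.1 x))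
    have hle := likelihood_le_sSup hv0 hpos
    have hlt : likelihood v φ * likelihood v ψ < likelihood v (fun z => √(φ z * ψ z)) ^ 2 := by
      simp_rw [likelihood_eq_prod_factor, ← Finset.prod_mul_distrib, ← Finset.prod_pow]
      refine Finset.prod_lt_prod (fun a _ => Finset.prod_pos fun b _ =>
        mul_pos (factor_pos hφ.1 a b) (factor_pos hψ.1 a b)) (fun a _ => Finset.prod_le_prod
        (fun b _ => (mul_pos (factor_pos hφ.1 a b) (factor_pos hψ.1 a b)).le)
        fun b _ => factor_mul_factor_le hv0 hφ.1 hψ.1 a b) ⟨x, Finset.mem_univ x, ?_⟩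
      exact Finset.prod_lt_prod (fun b _ => mul_pos (factor_pos hφ.1 x b) (factor_pos hψ.1 x b))
        (fun b _ => factor_mul_factor_le hv0 hφ.1 hψ.1 x b)
        ⟨y, Finset.mem_univ y, factor_mul_factor_lt hxy (hv x y hxy) hφ.1 hψ.1 hne⟩
    rw [h1, h2] at hlt
    have := likelihood_pos (v := v) hpos
    nlinarith
  funext x
  have := congrArg (fun f : A → ℝ => ∑ y, f y) (funext fun y => hprop x y)
  simp only [← Finset.mul_sum, ← Finset.sum_mul, hφ.2, hψ.2] at this
  linarith

/-- A limit on the boundary has a vanishing coordinate next to a positive one. The factor of that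
pair tends to zero and drags the likelihood with it, whereas the supremum is positive. -/
theorem tendsto_maximizing [Nonempty A] (hv : ∀ x y, x ≠ y → 0 < v x y) {s : ℕ → A → ℝ}
    (hs : IsMaximizingSeq v s) (h : Tendsto s atTop (𝓝 φ)) :
    φ ∈ openSimplex A ∧ likelihood v φ = sSup (likelihood v '' openSimplex A) := by
  have hv0 : ∀ x y, x ≠ y → 0 ≤ v x y := fun x y h => (hv x y h).le
  have hx := tendsto_pi_nhds.1 h
  have hsum : ∑ x, φ x = 1 := by
    have h1 : Tendsto (fun n => ∑ x, s n x) atTop (𝓝 (∑ x, φ x)) :=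
      tendsto_finsetSum _ fun x _ => hx x
    simp_rw [fun n => (hs.1 n).2] at h1
    exact tendsto_nhds_unique h1 tendsto_const_nhds
  have hnn : ∀ x, 0 ≤ φ x := fun x => ge_of_tendsto' (hx x) fun n => ((hs.1 n).1 x).le
  have hpos : ∀ x, 0 < φ x := by
    by_contra! hcon
    obtain ⟨y, hy⟩ := hcon
    have hy0 : φ y = 0 := le_antisymm hy (hnn y)
    obtain ⟨x, -, hx0⟩ : ∃ x ∈ Finset.univ, 0 < φ x := by
      by_contra! hcon
      have := Finset.sum_nonpos hcon
      linarith
    have hxy : y ≠ x := by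
      rintro rfl
      exact hx0.ne' hy0
    have ht := tendsto_factor (v := v) (hx y) (hx x) (by rw [hy0, zero_add]; exact hx0.ne')
      (Or.inr (hv y x hxy))
    have h0 : factor v φ y x = 0 := by
      rw [factor, if_neg hxy, hy0, zero_div, Real.zero_rpow (hv y x hxy).ne']
    rw [h0] at ht
    have := le_of_tendsto_of_tendsto' hs.2 ht fun n => by
      rw [likelihood_eq_prod_factor]
      exact prod_factor_le_factor hv0 (hs.1 n).1 (Finset.mem_univ y) (Finset.mem_univ x)
    exact absurd (sSup_likelihood_pos hv0) (not_lt.2 this)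
  refine ⟨⟨hpos, hsum⟩, tendsto_nhds_unique ?_ hs.2⟩
  simp_rw [likelihood_eq_prod_factor]
  exact tendsto_finsetProd _ fun x _ => tendsto_finsetProd _ fun y _ =>
    tendsto_factor (hx x) (hx y) (add_pos (hpos x) (hpos y)).ne' (Or.inl (hpos x).ne')

theorem exists_isStrengths_of_pos [Nonempty A] (hv : ∀ x y, x ≠ y → 0 < v x y) :
    ∃ φ ∈ openSimplex A, likelihood v φ = sSup (likelihood v '' openSimplex A) ∧
      IsStrengths v φ := by
  have hv0 : ∀ x y, x ≠ y → 0 ≤ v x y := fun x y h => (hv x y h).le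
  have hmem : ∀ {s : ℕ → A → ℝ}, IsMaximizingSeq v s → ∀ n, s n ∈ stdSimplex ℝ A :=
    fun hs n => ⟨fun x => ((hs.1 n).1 x).le, (hs.1 n).2⟩
  have hsub : ∀ {s : ℕ → A → ℝ}, IsMaximizingSeq v s → ∀ ns : ℕ → ℕ, Tendsto ns atTop atTop →
      IsMaximizingSeq v (s ∘ ns) :=
    fun hs ns hns => ⟨fun n => hs.1 _, hs.2.comp hns⟩
  obtain ⟨s, hs⟩ := exists_isMaximizingSeq hv0
  obtain ⟨φ, -, ns, hns, hlim⟩ := (isCompact_stdSimplex ℝ A).tendsto_subseq (hmem hs)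
  obtain ⟨h1, h2⟩ := tendsto_maximizing hv (hsub hs ns hns.tendsto_atTop) hlim
  -- Every subsequence of a maximizing sequence has a convergent further subsequence, and its limit
  -- is the unique maximizer.
  refine ⟨φ, h1, h2, fun r hr => tendsto_of_subseq_tendsto fun ks hks => ?_⟩
  have hr' := hsub hr ks hks
  obtain ⟨χ, -, ms, hms, hlim'⟩ := (isCompact_stdSimplex ℝ A).tendsto_subseq (hmem hr')
  obtain ⟨h3, h4⟩ := tendsto_maximizing hv (hsub hr' ms hms.tendsto_atTop) hlim'
  rw [maximizer_unique hv h1 h3 h2 h4]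
  exact ⟨ms, hlim'⟩

end Factor

/-! ### Strengths when a set of options dominates the rest -/

section Dominant

variable {A : Type*} [DecidableEq A] [Fintype A] {v : A → A → ℝ} {φ ψ : A → ℝ} {X : Finset A}

omit [Fintype A] in
theorem likelihood_restrict :
    likelihood (fun x y : {x // x ∈ X} => v x y) (fun x => φ x) =
      ∏ x ∈ X, ∏ y ∈ X, factor v φ x y := by
  rw [likelihood_eq_prod_factor, ← Finset.prod_coe_sort X fun x => ∏ y ∈ X, factor v φ x y]
  refine Finset.prod_congr rfl fun x _ => ?_
  rw [← Finset.prod_coe_sort X (factor v φ x)]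
  refine Finset.prod_congr rfl fun y _ => ?_
  simp only [factor, Subtype.ext_iff]

theorem likelihood_eq_of_dominant (hout : ∀ x ∈ X, ∀ y ∉ X, v y x = 0) :
    likelihood v φ = (∏ x ∈ X, ∏ y ∈ X, factor v φ x y) *
      (∏ x ∈ X, ∏ y ∈ Xᶜ, factor v φ x y) * ∏ x ∈ Xᶜ, ∏ y ∈ Xᶜ, factor v φ x y := by
  have h0 : ∏ x ∈ Xᶜ, ∏ y ∈ X, factor v φ x y = 1 :=
    Finset.prod_eq_one fun x hx => Finset.prod_eq_one fun y hy => by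
      rw [factor, hout y hy x (Finset.mem_compl.1 hx), Real.rpow_zero, ite_self]
  rw [likelihood_eq_prod_factor, ← Finset.prod_mul_prod_compl X]
  simp_rw [← Finset.prod_mul_prod_compl X (factor v φ _), Finset.prod_mul_distrib]
  rw [h0, one_mul]

/-- Glue `φ` on `X` to `ε * ψ` outside. By homogeneity neither diagonal block depends on `ε`, and
the cross block tends to one as `ε` tends to zero. -/
theorem le_likelihood_of_dominant [Nonempty A] (hv : ∀ x y, x ≠ y → 0 ≤ v x y)
    (hout : ∀ x ∈ X, ∀ y ∉ X, v y x = 0) (hφ : ∀ x ∈ X, 0 < φ x) (hψ : ∀ x, 0 < ψ x) :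
    (∏ x ∈ X, ∏ y ∈ X, factor v φ x y) * ∏ x ∈ Xᶜ, ∏ y ∈ Xᶜ, factor v ψ x y ≤
      sSup (likelihood v '' openSimplex A) := by
  set f : ℝ → A → ℝ := fun ε x => if x ∈ X then φ x else ε * ψ x with hf
  have hfX : ∀ ε, ∀ x ∈ X, f ε x = φ x := fun ε x hx => if_pos hx
  have hfXc : ∀ ε, ∀ x ∈ Xᶜ, f ε x = ε * ψ x := fun ε x hx => if_neg (Finset.mem_compl.1 hx)
  have hfpos : ∀ ε > 0, ∀ x, 0 < f ε x := by
    intro ε hε x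
    simp only [hf]
    split_ifs with h
    · exact hφ x h
    · exact mul_pos hε (hψ x)
  have hcross : Tendsto (fun ε => ∏ x ∈ X, ∏ y ∈ Xᶜ, factor v (f ε) x y) (𝓝[>] 0) (𝓝 1) := by
    have h1 : ∏ x ∈ X, ∏ y ∈ Xᶜ, factor v (f 0) x y = 1 :=
      Finset.prod_eq_one fun x hx => Finset.prod_eq_one fun y hy => by
        rw [factor, hfX 0 x hx, hfXc 0 y hy, zero_mul, add_zero, div_self (hφ x hx).ne',
          Real.one_rpow, ite_self]
    rw [← h1]
    refine tendsto_finsetProd _ fun x hx => tendsto_finsetProd _ fun y hy => ?_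
    have hx0 : f 0 x ≠ 0 := by rw [hfX 0 x hx]; exact (hφ x hx).ne'
    refine tendsto_factor ?_ ?_ ?_ (Or.inl hx0)
    · simp_rw [fun ε => hfX ε x hx]
      exact tendsto_const_nhds
    · simp_rw [fun ε => hfXc ε y hy]
      exact (tendsto_id.mono_left nhdsWithin_le_nhds).mul_const _
    · rw [hfXc 0 y hy, zero_mul, add_zero]
      exact hx0
  have hlim := (hcross.const_mul (∏ x ∈ X, ∏ y ∈ X, factor v φ x y)).mul_const
    (∏ x ∈ Xᶜ, ∏ y ∈ Xᶜ, factor v ψ x y)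
  rw [mul_one] at hlim
  refine le_of_tendsto hlim (eventually_nhdsWithin_of_forall fun ε hε => ?_)
  refine le_trans (le_of_eq ?_) (likelihood_le_sSup hv (hfpos ε hε))
  rw [likelihood_eq_of_dominant hout]
  congr 1
  · congr 1
    exact Finset.prod_congr rfl fun x hx => Finset.prod_congr rfl fun y hy =>
      factor_congr (fun _ => rfl) (hfX ε x hx).symm (hfX ε y hy).symm
  · refine Finset.prod_congr rfl fun x hx => Finset.prod_congr rfl fun y hy => ?_
    rw [← factor_smul (φ := ψ) hε x y]
    exact factor_congr (fun _ => rfl) (hfXc ε x hx).symm (hfXc ε y hy).symm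

/-- Since the two strengths add up to at most one, the strength of `y` is at most its share in the
pair, and that share tends to zero. -/
theorem tendsto_of_factor_tendsto_one {x y : A} (hxy : x ≠ y) (hv : 0 < v x y) {s : ℕ → A → ℝ}
    (hs : ∀ n, s n ∈ openSimplex A) (h : Tendsto (fun n => factor v (s n) x y) atTop (𝓝 1)) :
    Tendsto (fun n => s n y) atTop (𝓝 0) := by
  have h1 : Tendsto (fun n => factor v (s n) x y ^ (v x y)⁻¹) atTop (𝓝 1) := by
    have := h.rpow_const (p := (v x y)⁻¹) (Or.inl one_ne_zero)
    rwa [Real.one_rpow] at this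
  have h2 := h1.const_sub 1
  rw [sub_self] at h2
  refine squeeze_zero (fun n => ((hs n).1 y).le) (fun n => ?_) h2
  have hx := (hs n).1 x
  have hy := (hs n).1 y
  have hle : s n x + s n y ≤ 1 := by
    rw [← (hs n).2, ← Finset.sum_pair hxy]
    exact Finset.sum_le_sum_of_subset_of_nonneg (Finset.subset_univ _)
      fun z _ _ => ((hs n).1 z).le
  rw [factor, if_neg hxy, Real.rpow_rpow_inv (by positivity) hv.ne', le_sub_iff_add_le,
    ← le_sub_iff_add_le', div_le_iff₀ (by positivity)]
  nlinarith

/-- If the options in `X` beat each other and dominate the options outside `X`, the strengths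
exist, they are positive exactly on `X`, and there they are the strengths of the restriction. -/
theorem exists_isStrengths_of_dominant (hX : X.Nonempty) (hv : ∀ x y, x ≠ y → 0 ≤ v x y)
    (hin : ∀ x ∈ X, ∀ y ∈ X, x ≠ y → 0 < v x y)
    (hpos : ∀ x ∈ X, ∀ y ∉ X, 0 < v x y) (hout : ∀ x ∈ X, ∀ y ∉ X, v y x = 0) :
    ∃ φ, (∀ x ∈ X, 0 < φ x) ∧ (∀ y ∉ X, φ y = 0) ∧ IsStrengths v φ ∧
      IsStrengths (fun x y : {x // x ∈ X} => v x y) (fun x => φ x) := by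
  have : Nonempty {x // x ∈ X} := hX.to_subtype
  have : Nonempty A := ⟨hX.choose⟩
  have hvX : ∀ x y : {x // x ∈ X}, x ≠ y → 0 < v x y :=
    fun x y h => hin x x.2 y y.2 (Subtype.coe_ne_coe.2 h)
  obtain ⟨χ, hχ, hmax, hstr⟩ := exists_isStrengths_of_pos hvX
  set Φ : A → ℝ := fun x => if h : x ∈ X then χ ⟨x, h⟩ else 0 with hΦ
  have hΦX : ∀ x : {x // x ∈ X}, Φ x = χ x := fun x => dif_pos x.2
  have hΦpos : ∀ x ∈ X, 0 < Φ x := fun x hx => by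
    rw [hΦX ⟨x, hx⟩]
    exact hχ.1 _
  have hres : (fun x : {x // x ∈ X} => Φ x) = χ := funext hΦX
  refine ⟨Φ, hΦpos, fun y hy => dif_neg hy, ?_, by rwa [hres]⟩
  intro s hs
  set S := sSup (likelihood v '' openSimplex A)
  set SX := ∏ x ∈ X, ∏ y ∈ X, factor v Φ x y
  have hS : 0 < S := sSup_likelihood_pos hv
  have hSX : SX = sSup (likelihood (fun x y : {x // x ∈ X} => v x y) '' openSimplex _) := by
    rw [← hmax, ← hres, likelihood_restrict]
  have hSXpos : 0 < SX := by
    rw [hSX]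
    exact sSup_likelihood_pos fun x y h => (hvX x y h).le
  set I : ℕ → ℝ := fun n => ∏ x ∈ X, ∏ y ∈ X, factor v (s n) x y
  set C : ℕ → ℝ := fun n => ∏ x ∈ X, ∏ y ∈ Xᶜ, factor v (s n) x y
  have hIle : ∀ n, I n ≤ SX := fun n => by
    rw [hSX]
    have := likelihood_le_sSup (fun x y h => (hvX x y h).le)
      (fun x : {x // x ∈ X} => (hs.1 n).1 x)
    rwa [likelihood_restrict] at this
  have hI0 : ∀ n, 0 < I n := fun n =>
    Finset.prod_pos fun _ _ => Finset.prod_pos fun _ _ => factor_pos (hs.1 n).1 _ _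
  have hC0 : ∀ n, 0 < C n := fun n =>
    Finset.prod_pos fun _ _ => Finset.prod_pos fun _ _ => factor_pos (hs.1 n).1 _ _
  have hC1 : ∀ n, C n ≤ 1 := fun n => prod_factor_le_one hv (hs.1 n).1 _ _
  -- Exchanging the inner block of `s n` for its optimum and the cross block for one yields at most
  -- `S`. Thus inner and cross block lose no more than the whole likelihood does, and both are
  -- squeezed to their suprema.
  have hlow : ∀ n, likelihood v (s n) / S * SX ≤ I n * C n := by
    intro n
    have h1 := le_likelihood_of_dominant hv hout hΦpos (hs.1 n).1
    rw [likelihood_eq_of_dominant hout, div_mul_eq_mul_div, div_le_iff₀ hS]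
    calc _ = I n * C n * (SX * ∏ x ∈ Xᶜ, ∏ y ∈ Xᶜ, factor v (s n) x y) := by ring
      _ ≤ _ := mul_le_mul_of_nonneg_left h1 (mul_pos (hI0 n) (hC0 n)).le
  have hlim : Tendsto (fun n => likelihood v (s n) / S * SX) atTop (𝓝 SX) := by
    have := (hs.2.div_const S).mul_const SX
    rwa [div_self hS.ne', one_mul] at this
  have hI : Tendsto I atTop (𝓝 SX) :=
    tendsto_of_tendsto_of_tendsto_of_le_of_le hlim tendsto_const_nhds
      (fun n => (hlow n).trans (mul_le_of_le_one_right (hI0 n).le (hC1 n))) hIle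
  have hC : Tendsto C atTop (𝓝 1) := by
    have h1 := hlim.div_const SX
    rw [div_self hSXpos.ne'] at h1
    refine tendsto_of_tendsto_of_tendsto_of_le_of_le h1 tendsto_const_nhds (fun n => ?_) hC1
    rw [div_le_iff₀ hSXpos, mul_comm (C n)]
    exact (hlow n).trans (mul_le_mul_of_nonneg_right (hIle n) (hC0 n).le)
  have hzero : ∀ y ∉ X, Tendsto (fun n => s n y) atTop (𝓝 0) := by
    intro y hy
    obtain ⟨x, hx⟩ := hX
    refine tendsto_of_factor_tendsto_one (ne_of_mem_of_not_mem hx hy) (hpos x hx y hy) hs.1 ?_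
    exact tendsto_of_tendsto_of_tendsto_of_le_of_le hC tendsto_const_nhds
      (fun n => prod_factor_le_factor hv (hs.1 n).1 hx (Finset.mem_compl.2 hy))
      fun n => factor_le_one hv (hs.1 n).1 x y
  have hsum : Tendsto (fun n => ∑ x : {x // x ∈ X}, s n x) atTop (𝓝 1) := by
    have h1 : Tendsto (fun n => 1 - ∑ y ∈ Xᶜ, s n y) atTop (𝓝 (1 - ∑ y ∈ Xᶜ, (0 : ℝ))) :=
      (tendsto_finsetSum _ fun y hy => hzero y (Finset.mem_compl.1 hy)).const_sub 1
    rw [Finset.sum_const_zero, sub_zero] at h1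
    refine h1.congr fun n => ?_
    rw [Finset.sum_coe_sort X (s n), ← (hs.1 n).2, ← Finset.sum_add_sum_compl X (s n),
      add_sub_cancel_right]
  -- Rescaled to sum one on `X`, the sequence maximizes the inner likelihood. The rescaling factor
  -- disappears in the limit because the mass on `X` tends to one.
  have hnorm : Tendsto (fun n => normalized fun x : {x // x ∈ X} => s n x) atTop (𝓝 χ) := by
    refine hstr _ ⟨fun n => normalized_mem fun x => (hs.1 n).1 x, ?_⟩
    rw [← hSX]
    refine hI.congr fun n => ?_
    rw [likelihood_normalized fun x : {x // x ∈ X} => (hs.1 n).1 x, likelihood_restrict]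
  refine tendsto_pi_nhds.2 fun x => ?_
  by_cases hx : x ∈ X
  · have h1 := hsum.mul (tendsto_pi_nhds.1 hnorm ⟨x, hx⟩)
    rw [one_mul, ← hΦX] at h1
    refine h1.congr fun n => ?_
    rw [normalized, ← mul_assoc, mul_inv_cancel₀, one_mul]
    exact (Finset.sum_pos (fun x _ => (hs.1 n).1 _) Finset.univ_nonempty).ne'
  · rw [show Φ x = 0 from dif_neg hx]
    exact hzero x hx

end Dominant

/-! ### Indirect scores, admissible orders, and sets that no score enters -/

section Indirect

variable {A : Type*} {v : A → A → ℝ}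

theorem transGen_of_path {R : A → A → Prop} {n : ℕ} (p : Fin (n + 2) → A)
    (h : ∀ i : Fin (n + 1), R (p i.castSucc) (p i.succ)) :
    Relation.TransGen R (p 0) (p (Fin.last (n + 1))) := by
  induction n with
  | zero => exact .single (h 0)
  | succ n ih =>
    have h1 := ih (fun i => p i.castSucc) fun i => h i.castSucc
    exact h1.tail (h (Fin.last (n + 1)))

theorem exists_path_of_transGen {R : A → A → Prop} {x y : A} (h : Relation.TransGen R x y) :
    ∃ (n : ℕ) (p : Fin (n + 2) → A), p 0 = x ∧ p (Fin.last (n + 1)) = y ∧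
      ∀ i : Fin (n + 1), R (p i.castSucc) (p i.succ) := by
  induction h with
  | @single z h =>
    refine ⟨0, ![x, z], rfl, rfl, fun i => ?_⟩
    fin_cases i
    exact h
  | @tail y z _ h ih =>
    obtain ⟨n, p, h0, h1, hp⟩ := ih
    refine ⟨n + 1, Fin.snoc p z, ?_, Fin.snoc_last _ _, fun i => ?_⟩
    · rw [← h0, ← Fin.castSucc_zero, Fin.snoc_castSucc]
    · induction i using Fin.lastCases with
      | last =>
        rw [Fin.snoc_castSucc, Fin.succ_last, Fin.snoc_last, h1]
        exact h
      | cast i =>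
        rw [Fin.snoc_castSucc, ← Fin.castSucc_succ, Fin.snoc_castSucc]
        exact hp i

/-- Path scores are entries of a finite matrix, so the supremum is attained. Indirect scores thereby
become reachability in the graph of links at a given threshold. -/
theorem le_indirectScore_iff [Finite A] {x y : A} (hxy : x ≠ y) {s : ℝ} :
    s ≤ indirectScore v x y ↔ Relation.TransGen (fun a b => a ≠ b ∧ s ≤ v a b) x y := by
  have hfin : {s | ∃ (n : ℕ) (p : Fin (n + 2) → A), p 0 = x ∧ p (Fin.last (n + 1)) = y ∧
      (∀ i : Fin (n + 1), p i.castSucc ≠ p i.succ) ∧ s = pathScore v p}.Finite := by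
    refine (Set.finite_range fun q : A × A => v q.1 q.2).subset ?_
    rintro _ ⟨n, p, -, -, -, rfl⟩
    obtain ⟨i, hi⟩ := exists_eq_ciInf_of_finite
      (f := fun i : Fin (n + 1) => v (p i.castSucc) (p i.succ))
    exact ⟨(p i.castSucc, p i.succ), hi⟩
  constructor
  · intro hs
    have hne : {s | ∃ (n : ℕ) (p : Fin (n + 2) → A), p 0 = x ∧ p (Fin.last (n + 1)) = y ∧
        (∀ i : Fin (n + 1), p i.castSucc ≠ p i.succ) ∧ s = pathScore v p}.Nonempty := by
      refine ⟨_, 0, ![x, y], rfl, rfl, fun i => ?_, rfl⟩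
      fin_cases i
      exact hxy
    obtain ⟨n, p, h0, h1, hp, heq⟩ := hne.csSup_mem hfin
    rw [← h0, ← h1]
    refine transGen_of_path p fun i => ⟨hp i, hs.trans ?_⟩
    rw [indirectScore, heq, pathScore]
    exact ciInf_le (Set.finite_range _).bddBelow i
  · intro h
    obtain ⟨n, p, h0, h1, hp⟩ := exists_path_of_transGen h
    refine le_trans ?_ (le_csSup hfin.bddAbove ⟨n, p, h0, h1, fun i => (hp i).1, rfl⟩)
    exact le_ciInf fun i => (hp i).2

variable [Finite A]

theorem le_indirectScore {x y : A} (hxy : x ≠ y) : v x y ≤ indirectScore v x y :=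
  (le_indirectScore_iff hxy).2 (.single ⟨hxy, le_rfl⟩)

theorem indirectScore_le_one (hv : IsLlull v) {x y : A} (hxy : x ≠ y) :
    indirectScore v x y ≤ 1 := by
  obtain ⟨z, h, -⟩ := Relation.TransGen.head'_iff.1 ((le_indirectScore_iff hxy).1 le_rfl)
  exact h.2.trans (hv x z h.1).2.1

theorem indirectScore_nonneg (hv : IsLlull v) {x y : A} (hxy : x ≠ y) :
    0 ≤ indirectScore v x y :=
  (hv x y hxy).1.trans (le_indirectScore hxy)

theorem indirectMargin_le_one (hv : IsLlull v) {x y : A} (hxy : x ≠ y) :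
    indirectMargin v x y ≤ 1 := by
  have := indirectScore_le_one hv hxy
  have := indirectScore_nonneg hv hxy.symm
  unfold indirectMargin
  linarith

omit [Finite A] in
theorem indirectMargin_neg (x y : A) : indirectMargin v y x = -indirectMargin v x y := by
  unfold indirectMargin
  ring

/-- Schulze's argument: were the margin of `x` over `z` not positive, concatenation of paths would
give a way back along the weaker of the two given links that is as strong as that link, so its
margin would not be positive. -/
theorem indirectMargin_pos_trans {x y z : A} (hxy : 0 < indirectMargin v x y)
    (hyz : 0 < indirectMargin v y z) : 0 < indirectMargin v x z := by
  have key : ∀ {a b c : A} {s : ℝ}, a ≠ b → b ≠ c → a ≠ c → s ≤ indirectScore v a b →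
      s ≤ indirectScore v b c → s ≤ indirectScore v a c := fun h1 h2 h3 h4 h5 =>
    (le_indirectScore_iff h3).2
      (((le_indirectScore_iff h1).1 h4).trans ((le_indirectScore_iff h2).1 h5))
  have hself : ∀ a, indirectMargin v a a = 0 := fun a => sub_self _
  have n1 : x ≠ y := by
    rintro rfl
    rw [hself] at hxy
    exact lt_irrefl _ hxy
  have n2 : y ≠ z := by
    rintro rfl
    rw [hself] at hyz
    exact lt_irrefl _ hyz
  have n3 : x ≠ z := by
    rintro rfl
    rw [indirectMargin_neg] at hyz
    linarith
  unfold indirectMargin at *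
  by_contra! hcon
  rcases le_total (indirectScore v x y) (indirectScore v y z) with h | h
  · have h1 := key n1 n2 n3 le_rfl h
    have h2 := key n2 n3.symm n1.symm h (h1.trans (by linarith))
    linarith
  · have h1 := key n1 n2 n3 h le_rfl
    have h2 := key n3.symm n1 n2.symm (h1.trans (by linarith)) h
    linarith

-- Positive indirect margin is a strict partial order. In any linear extension no option has a
-- positive margin over an earlier one.
omit [Finite A] in
theorem exists_isAdmissible [Fintype A] (v : A → A → ℝ) : ∃ ξ, IsAdmissible v ξ := by
  classical
  let r : A → A → Prop := fun x y => x = y ∨ 0 < indirectMargin v x y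
  have hr : IsPartialOrder A r :=
    { refl := fun x => Or.inl rfl
      trans := by
        rintro x y z (rfl | h1) (rfl | h2)
        · exact Or.inl rfl
        · exact Or.inr h2
        · exact Or.inr h1
        · exact Or.inr (indirectMargin_pos_trans h1 h2)
      antisymm := by
        rintro x y (rfl | h1) (h2 | h2)
        · rfl
        · rfl
        · exact h2.symm
        · rw [indirectMargin_neg] at h2
          linarith }
  obtain ⟨s, hs, hrs⟩ := extend_partialOrder r
  let O : LinearOrder A :=
    { le := s
      le_refl := hs.refl
      le_trans := hs.trans
      lt_iff_le_not_ge := fun _ _ => Iff.rfl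
      le_antisymm := hs.antisymm
      le_total := hs.total
      toDecidableLE := Classical.decRel _ }
  let e : Fin (Fintype.card A) ≃o A := Fintype.orderIsoFinOfCardEq A rfl
  refine ⟨e.symm.toEquiv, fun x y hxy => ?_⟩
  by_contra! hcon
  have h1 : 0 < indirectMargin v y x := by
    rw [indirectMargin_neg]
    linarith
  have h2 : y ≤ x := hrs y x (Or.inr h1)
  exact absurd (e.symm.monotone h2) (not_le.2 hxy)

/-- No score leads from outside `X` into `X`. -/
theorem indirectScore_eq_zero (hv : IsLlull v) {X : Finset A}
    (hX : ∀ x ∈ X, ∀ y ∉ X, v y x = 0) {x y : A} (hx : x ∈ X) (hy : y ∉ X) :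
    indirectScore v y x = 0 := by
  have hne : y ≠ x := (ne_of_mem_of_not_mem hx hy).symm
  refine le_antisymm ?_ (indirectScore_nonneg hv hne)
  by_contra! hpos
  have h := (le_indirectScore_iff hne).1 (le_refl (indirectScore v y x))
  have hmem : y ∈ X := by
    refine h.head_induction_on (motive := fun a _ => a ∈ X) ?_ ?_
    · intro a h1
      by_contra ha
      linarith [h1.2, hX x hx a ha]
    · intro a c h1 _ hc
      by_contra ha
      linarith [h1.2, hX c hc a ha]
  exact hy hmem

omit [Finite A] in
theorem UnanimouslyPreferred.eq_zero (hv : IsLlull v) {X : Finset A}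
    (hX : UnanimouslyPreferred v X) : ∀ x ∈ X, ∀ y ∉ X, v y x = 0 := by
  intro x hx y hy
  have hne : y ≠ x := (ne_of_mem_of_not_mem hx hy).symm
  linarith [hX x hx y hy, (hv y x hne).1, (hv y x hne).2.2]

theorem UnanimouslyPreferred.indirectMargin_eq_one (hv : IsLlull v) {X : Finset A}
    (hX : UnanimouslyPreferred v X) {x y : A} (hx : x ∈ X) (hy : y ∉ X) :
    indirectMargin v x y = 1 := by
  have hne : x ≠ y := ne_of_mem_of_not_mem hx hy
  have h1 := le_indirectScore (v := v) hne
  rw [hX x hx y hy] at h1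
  rw [indirectMargin, indirectScore_eq_zero hv (hX.eq_zero hv) hx hy, sub_zero]
  exact le_antisymm (indirectScore_le_one hv hne) h1

theorem eq_zero_of_indirectMargin_eq_one (hv : IsLlull v) {x y : A} (hxy : x ≠ y)
    (h : indirectMargin v x y = 1) : v y x = 0 := by
  have h1 := indirectScore_le_one hv hxy
  have h2 := le_indirectScore (v := v) hxy.symm
  have h3 := (hv y x hxy.symm).1
  unfold indirectMargin at h
  linarith

/-- A path that ends in `X` with a positive weakest link never was outside `X`, because the link
entering `X` would have score zero. -/
theorem indirectScore_restrict (hv : IsLlull v) {X : Finset A}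
    (hX : ∀ x ∈ X, ∀ y ∉ X, v y x = 0) {x y : {x // x ∈ X}} (hxy : x ≠ y) :
    indirectScore (fun x y : {x // x ∈ X} => v x y) x y = indirectScore v x y := by
  have hxy' : (x : A) ≠ y := Subtype.coe_ne_coe.2 hxy
  apply le_antisymm
  · rw [le_indirectScore_iff hxy']
    exact ((le_indirectScore_iff hxy).1 le_rfl).lift _ fun a b h =>
      ⟨Subtype.coe_ne_coe.2 h.1, h.2⟩
  -- At score zero an optimal path may wander outside `X`; there the direct link suffices.
  · rcases (indirectScore_nonneg hv hxy').eq_or_lt with h0 | h0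
    · rw [← h0]
      exact (hv x y hxy').1.trans
        (le_indirectScore (v := fun x y : {x // x ∈ X} => v x y) hxy)
    · rw [le_indirectScore_iff hxy]
      have h := (le_indirectScore_iff hxy').1 (le_refl (indirectScore v x y))
      have key : ∃ hx : (x : A) ∈ X, Relation.TransGen
          (fun a b : {x // x ∈ X} => a ≠ b ∧ indirectScore v x y ≤ v a b) ⟨x, hx⟩ y := by
        refine h.head_induction_on (motive := fun a _ => ∃ ha : a ∈ X, Relation.TransGen
          (fun a b : {x // x ∈ X} => a ≠ b ∧ indirectScore v x y ≤ v a b) ⟨a, ha⟩ y) ?_ ?_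
        · intro a h1
          have ha : a ∈ X := by
            by_contra ha
            linarith [h1.2, hX y y.2 a ha]
          exact ⟨ha, .single ⟨fun e => h1.1 (congrArg Subtype.val e), h1.2⟩⟩
        · rintro a c h1 - ⟨hc, hcy⟩
          have ha : a ∈ X := by
            by_contra ha
            linarith [h1.2, hX c hc a ha]
          exact ⟨ha, .head ⟨fun e => h1.1 (congrArg Subtype.val e), h1.2⟩ hcy⟩
      exact key.2

theorem indirectMargin_restrict (hv : IsLlull v) {X : Finset A}
    (hX : ∀ x ∈ X, ∀ y ∉ X, v y x = 0) (x y : {x // x ∈ X}) :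
    indirectMargin (fun x y : {x // x ∈ X} => v x y) x y = indirectMargin v x y := by
  rcases eq_or_ne x y with rfl | hxy
  · simp only [indirectMargin, sub_self]
  · rw [indirectMargin, indirectMargin, indirectScore_restrict hv hX hxy,
      indirectScore_restrict hv hX hxy.symm]

end Indirect

/-! ### The turnout constraints as inequalities between positions -/

/-- The constraints on the intermediate projected turnouts, where the options are replaced by their
positions `0, 1, …, n - 1` in the admissible order. Here `M i` is the margin between the
positions `i` and `i + 1`. -/
structure IsStaircase (n : ℕ) (M : ℕ → ℝ) (T : ℕ → ℕ → ℝ) : Prop where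
  symm : ∀ i j, T i j = T j i
  margin_nonneg : ∀ i, i + 1 < n → 0 ≤ M i
  margin_le : ∀ i, i + 1 < n → M i ≤ T i (i + 1)
  le_one : ∀ i, i + 1 < n → T i (i + 1) ≤ 1
  step : ∀ i k, i + 1 < n → k < n → k ≠ i → k ≠ i + 1 →
    0 ≤ T i k - T (i + 1) k ∧ T i k - T (i + 1) k ≤ M i

/-- All the margins between the positions `i` and `j` vanish. -/
def Tied (M : ℕ → ℝ) (i j : ℕ) : Prop :=
  ∀ k, (i ≤ k ∧ k < j ∨ j ≤ k ∧ k < i) → M k = 0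

/-- Upper end of the interval between the positions `k` and `k + 1`. -/
noncomputable def upperEnd (M : ℕ → ℝ) (T : ℕ → ℕ → ℝ) (k : ℕ) : ℝ := (T k (k + 1) + M k) / 2

/-- Lower end of the interval between the positions `k` and `k + 1`. -/
noncomputable def lowerEnd (M : ℕ → ℝ) (T : ℕ → ℕ → ℝ) (k : ℕ) : ℝ := (T k (k + 1) - M k) / 2

namespace IsStaircase

variable {n : ℕ} {M : ℕ → ℝ} {T : ℕ → ℕ → ℝ} (h : IsStaircase n M T)
include h

theorem sub_mem_of_lt_or_lt {i j k : ℕ} (hij : i ≤ j) (hj : j < n) (hk : k < n)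
    (hkij : k < i ∨ j < k) : 0 ≤ T i k - T j k ∧ T i k - T j k ≤ ∑ m ∈ Finset.Ico i j, M m := by
  induction j, hij using Nat.le_induction with
  | base => simp
  | succ j hij ih =>
    obtain ⟨h1, h2⟩ := ih (by omega) (by omega)
    obtain ⟨h3, h4⟩ := h.step j k hj hk (by omega) (by omega)
    rw [Finset.sum_Ico_succ_top hij]
    constructor <;> linarith

theorem sub_mem {i j k : ℕ} (hij : i ≤ j) (hj : j < n) (hk : k < n) (hki : k ≠ i) (hkj : k ≠ j) :
    0 ≤ T i k - T j k ∧ T i k - T j k ≤ ∑ m ∈ Finset.Ico i j, M m := by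
  by_cases hout : k < i ∨ j < k
  · exact h.sub_mem_of_lt_or_lt hij hj hk hout
  -- Telescoping down column `k` would cross the diagonal at `k = m + 1`. The step from `m` to `m +
  -- 2` is made instead through the entry at `(m, m + 2)`, using symmetry, and costs at most `M m +
  -- M (m + 1)`.
  obtain ⟨m, rfl⟩ : ∃ m, k = m + 1 := ⟨k - 1, by omega⟩
  obtain ⟨h1, h2⟩ := h.sub_mem_of_lt_or_lt (i := i) (j := m) (k := m + 1) (by omega) (by omega) hk
    (by omega)
  obtain ⟨h3, h4⟩ := h.sub_mem_of_lt_or_lt (i := m + 1 + 1) (j := j) (k := m + 1) (by omega) hj hk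
    (by omega)
  obtain ⟨h5, h6⟩ := h.step m (m + 1 + 1) (by omega) (by omega) (by omega) (by omega)
  obtain ⟨h7, h8⟩ := h.step (m + 1) m (by omega) (by omega) (by omega) (by omega)
  have e1 := h.symm m (m + 1)
  have e2 := h.symm m (m + 1 + 1)
  have e3 := h.symm (m + 1) (m + 1 + 1)
  rw [← Finset.sum_Ico_consecutive M (show i ≤ m by omega) (show m ≤ j by omega),
    Finset.sum_eq_sum_Ico_succ_bot (show m < j by omega),
    Finset.sum_eq_sum_Ico_succ_bot (show m + 1 < j by omega)]
  constructor <;> linarith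

/-- One index is moved at a time, by way of the entry at `(i, j + 1)`. -/
theorem consecutive_sub_mem {i j : ℕ} (hij : i ≤ j) (hj : j + 1 < n) :
    0 ≤ T i (i + 1) - T j (j + 1) ∧ T i (i + 1) - T j (j + 1) ≤
      ∑ m ∈ Finset.Ico (i + 1) (j + 1), M m + ∑ m ∈ Finset.Ico i j, M m := by
  obtain ⟨h1, h2⟩ := h.sub_mem (i := i + 1) (j := j + 1) (k := i) (by omega) hj (by omega)
    (by omega) (by omega)
  obtain ⟨h3, h4⟩ := h.sub_mem (i := i) (j := j) (k := j + 1) (by omega) (by omega) (by omega)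
    (by omega) (by omega)
  rw [h.symm i (i + 1)]
  rw [h.symm i (j + 1)] at h3 h4
  constructor <;> linarith

theorem le_consecutive {i j : ℕ} (hij : i < j) (hj : j < n) : T i j ≤ T i (i + 1) := by
  have := (h.sub_mem (i := i + 1) (j := j) (k := i) (by omega) hj (by omega)
    (by omega) (by omega)).1
  rw [h.symm i j, h.symm i (i + 1)]
  linarith

theorem nonneg_of_lt {i j : ℕ} (hij : i < j) (hj : j < n) : 0 ≤ T i j := by
  obtain ⟨m, rfl⟩ : ∃ m, j = m + 1 := ⟨j - 1, by omega⟩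
  have h1 := (h.sub_mem (i := i) (j := m) (k := m + 1) (by omega) (by omega) hj
    (by omega) (by omega)).1
  have h2 := h.margin_le m hj
  have h3 := h.margin_nonneg m hj
  linarith

theorem mem_unit {i j : ℕ} (hij : i ≠ j) (hi : i < n) (hj : j < n) : 0 ≤ T i j ∧ T i j ≤ 1 := by
  rcases lt_or_gt_of_ne hij with hlt | hlt
  · exact ⟨h.nonneg_of_lt hlt hj, (h.le_consecutive hlt hj).trans (h.le_one i (by omega))⟩
  · rw [h.symm]
    exact ⟨h.nonneg_of_lt hlt hi, (h.le_consecutive hlt hi).trans (h.le_one j (by omega))⟩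

theorem lowerEnd_nonneg {k : ℕ} (hk : k + 1 < n) : 0 ≤ lowerEnd M T k := by
  have := h.margin_le k hk
  unfold lowerEnd
  linarith

theorem lowerEnd_le_upperEnd {k : ℕ} (hk : k + 1 < n) : lowerEnd M T k ≤ upperEnd M T k := by
  have := h.margin_nonneg k hk
  unfold lowerEnd upperEnd
  linarith

/-- Consecutive intervals overlap. -/
theorem lowerEnd_le_upperEnd_succ {k : ℕ} (hk : k + 2 < n) :
    lowerEnd M T k ≤ upperEnd M T (k + 1) := by
  have := (h.consecutive_sub_mem (i := k) (j := k + 1) (by omega) (by omega)).2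
  simp only [Nat.Ico_succ_singleton, Finset.sum_singleton] at this
  unfold lowerEnd upperEnd
  linarith

theorem eq_of_tied {i j k : ℕ} (hi : i < n) (hj : j < n) (hk : k < n) (hki : k ≠ i) (hkj : k ≠ j)
    (ht : Tied M i j) : T i k = T j k := by
  rcases le_total i j with hij | hij
  · obtain ⟨h1, h2⟩ := h.sub_mem hij hj hk hki hkj
    rw [Finset.sum_eq_zero fun m hm => ht m (Or.inl (Finset.mem_Ico.1 hm))] at h2
    linarith
  · obtain ⟨h1, h2⟩ := h.sub_mem hij hi hk hkj hki
    rw [Finset.sum_eq_zero fun m hm => ht m (Or.inr (Finset.mem_Ico.1 hm))] at h2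
    linarith

/-- The indices are exchanged one after the other, in whichever order keeps the intermediate entry
off the diagonal. If neither order does, the two pairs are swapped and symmetry applies. -/
theorem eq_of_tied_of_tied {i j i' j' : ℕ} (hi : i < n) (hj : j < n) (hi' : i' < n) (hj' : j' < n)
    (hij : i ≠ j) (hij' : i' ≠ j') (hti : Tied M i i') (htj : Tied M j j') :
    T i j = T i' j' := by
  by_cases h1 : j = i'
  · by_cases h2 : i = j'
    · rw [h1, h2, h.symm]
    · subst h1
      rw [h.symm i j, h.eq_of_tied hj hj' hi hij h2 htj, h.symm j' i,
        h.eq_of_tied hi hi' hj' (Ne.symm h2) hij'.symm hti]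
  · rw [h.eq_of_tied hi hi' hj hij.symm h1 hti, h.symm i' j,
      h.eq_of_tied hj hj' hi' (Ne.symm h1) hij' htj, h.symm j' i']

/-- An interval of the old range that is missing from the new one has margin zero, so it is a point.
It lies in the nearest end interval of the new range, as every margin in between vanishes except
possibly that interval's own. -/
theorem exists_wider_of_tied {i j i' j' : ℕ} (hj : j < n) (hj' : j' < n)
    (hij' : i' < j') (hti : Tied M i i') (htj : Tied M j j') {k : ℕ} (hik : i ≤ k) (hkj : k < j) :
    ∃ k', i' ≤ k' ∧ k' < j' ∧ upperEnd M T k ≤ upperEnd M T k' ∧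
      lowerEnd M T k' ≤ lowerEnd M T k := by
  unfold upperEnd lowerEnd
  by_cases h1 : k < i'
  · obtain ⟨h2, h3⟩ := h.consecutive_sub_mem (i := k) (j := i') h1.le (by omega)
    rw [Finset.sum_Ico_succ_top (by omega), Finset.sum_eq_zero fun m hm => hti m (Or.inl ?_),
      Finset.sum_eq_zero fun m hm => hti m (Or.inl ?_)] at h3
    · have h4 := hti k (Or.inl ⟨hik, h1⟩)
      have h5 := h.margin_nonneg i' (by omega)
      refine ⟨i', le_rfl, hij', ?_, ?_⟩ <;> linarith
    · rw [Finset.mem_Ico] at hm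
      omega
    · rw [Finset.mem_Ico] at hm
      omega
  by_cases h2 : k < j'
  · exact ⟨k, by omega, h2, le_rfl, le_rfl⟩
  · obtain ⟨m, rfl⟩ : ∃ m, j' = m + 1 := ⟨j' - 1, by omega⟩
    obtain ⟨h2, h3⟩ := h.consecutive_sub_mem (i := m) (j := k) (by omega) (by omega)
    rw [Finset.sum_eq_sum_Ico_succ_bot (show m < k by omega),
      Finset.sum_eq_zero fun m hm => htj m (Or.inr ?_),
      Finset.sum_eq_zero fun m hm => htj m (Or.inr ?_)] at h3
    · have h4 := htj k (Or.inr ⟨by omega, hkj⟩)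
      have h5 := h.margin_nonneg m (by omega)
      refine ⟨m, by omega, by omega, ?_, ?_⟩ <;> linarith
    · rw [Finset.mem_Ico] at hm
      omega
    · rw [Finset.mem_Ico] at hm
      omega

/-- When the two orders rank the pair oppositely, all margins over both ranges vanish and all their
intervals shrink to one common point. -/
theorem ends_eq_of_tied_of_crossing {i j i' j' : ℕ} (hj : j < n) (hi' : i' < n)
    (hti : Tied M i i') (htj : Tied M j j') {k k' : ℕ} (hik : i ≤ k) (hkj : k < j)
    (hjk : j' ≤ k') (hki : k' < i') :
    upperEnd M T k = lowerEnd M T k' ∧ lowerEnd M T k = upperEnd M T k' := by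
  have hM : ∀ m, (i ≤ m ∨ j' ≤ m) → (m < j ∨ m < i') → M m = 0 := by
    intro m h1 h2
    by_cases h3 : i ≤ m ∧ m < i' ∨ i' ≤ m ∧ m < i
    · exact hti m h3
    · exact htj m (by omega)
  have hT : T k (k + 1) = T k' (k' + 1) := by
    rcases le_total k k' with hk | hk
    · obtain ⟨h1, h2⟩ := h.consecutive_sub_mem hk (by omega)
      rw [Finset.sum_eq_zero fun m hm => hM m ?_ ?_,
        Finset.sum_eq_zero fun m hm => hM m ?_ ?_] at h2
      · linarith
      all_goals
        rw [Finset.mem_Ico] at hm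
        omega
    · obtain ⟨h1, h2⟩ := h.consecutive_sub_mem hk (by omega)
      rw [Finset.sum_eq_zero fun m hm => hM m ?_ ?_,
        Finset.sum_eq_zero fun m hm => hM m ?_ ?_] at h2
      · linarith
      all_goals
        rw [Finset.mem_Ico] at hm
        omega
  have h1 := hM k (Or.inl hik) (Or.inl hkj)
  have h2 := hM k' (Or.inr hjk) (Or.inr hki)
  unfold upperEnd lowerEnd
  rw [hT, h1, h2]
  simp

end IsStaircase

/-! ### From options to positions; projected scores along the order -/

section Order

variable {A : Type*} [Fintype A] {v π : A → A → ℝ} {τ : A → A → ℝ}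
  {ξ η : A ≃ Fin (Fintype.card A)}

/-- The minimum of the indirect margins of an option whose position is at most `k` over an option
whose position is larger than `k`. -/
noncomputable def cutMargin (v : A → A → ℝ) (ξ : A ≃ Fin (Fintype.card A)) (k : ℕ) : ℝ :=
  sInf {m | ∃ p q, (ξ p : ℕ) ≤ k ∧ k < (ξ q : ℕ) ∧ m = indirectMargin v p q}

/-- The matrix `τ` with the options replaced by their positions. -/
noncomputable def posMatrix (ξ : A ≃ Fin (Fintype.card A)) (τ : A → A → ℝ) (i j : ℕ) : ℝ :=
  if h : i < Fintype.card A ∧ j < Fintype.card A then τ (ξ.symm ⟨i, h.1⟩) (ξ.symm ⟨j, h.2⟩) else 0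

theorem exists_position (ξ : A ≃ Fin (Fintype.card A)) {i : ℕ} (hi : i < Fintype.card A) :
    ∃ x, (ξ x : ℕ) = i :=
  ⟨ξ.symm ⟨i, hi⟩, by rw [ξ.apply_symm_apply]⟩

theorem position_ne {x y : A} : (ξ x : ℕ) ≠ ξ y ↔ x ≠ y := by
  rw [Ne, Fin.val_inj, ξ.injective.eq_iff]

theorem posMatrix_apply (x y : A) : posMatrix ξ τ (ξ x) (ξ y) = τ x y := by
  rw [posMatrix, dif_pos ⟨(ξ x).2, (ξ y).2⟩]
  simp

theorem posMatrix_symm (hτ : ∀ x y, τ x y = τ y x) (i j : ℕ) :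
    posMatrix ξ τ i j = posMatrix ξ τ j i := by
  unfold posMatrix
  by_cases h : i < Fintype.card A ∧ j < Fintype.card A
  · rw [dif_pos h, dif_pos h.symm, hτ]
  · rw [dif_neg h, dif_neg fun h' => h h'.symm]

theorem finite_cut (v : A → A → ℝ) (ξ : A ≃ Fin (Fintype.card A)) (k : ℕ) :
    {m | ∃ p q, (ξ p : ℕ) ≤ k ∧ k < (ξ q : ℕ) ∧ m = indirectMargin v p q}.Finite := by
  refine (Set.finite_range fun q : A × A => indirectMargin v q.1 q.2).subset ?_
  rintro _ ⟨p, q, -, -, rfl⟩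
  exact ⟨(p, q), rfl⟩

theorem cutMargin_le {k : ℕ} {p q : A} (hp : (ξ p : ℕ) ≤ k) (hq : k < (ξ q : ℕ)) :
    cutMargin v ξ k ≤ indirectMargin v p q :=
  csInf_le (finite_cut v ξ k).bddBelow ⟨p, q, hp, hq, rfl⟩

theorem le_cutMargin_iff {k : ℕ} (hk : k + 1 < Fintype.card A) {c : ℝ} :
    c ≤ cutMargin v ξ k ↔
      ∀ p q, (ξ p : ℕ) ≤ k → k < (ξ q : ℕ) → c ≤ indirectMargin v p q := by
  refine ⟨fun h p q hp hq => h.trans (cutMargin_le hp hq), fun h => ?_⟩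
  obtain ⟨p, hp⟩ := exists_position ξ (show k < Fintype.card A by omega)
  obtain ⟨q, hq⟩ := exists_position ξ hk
  refine le_csInf ⟨_, p, q, hp.le, by omega, rfl⟩ ?_
  rintro _ ⟨p, q, hp, hq, rfl⟩
  exact h p q hp hq

theorem projMargin_eq {x x' : A} (h : Next ξ x x') : projMargin v ξ x x' = cutMargin v ξ (ξ x) := by
  have : ∀ p q, (ξ p ≤ ξ x ∧ ξ x' ≤ ξ q ∧ True) ↔ ((ξ p : ℕ) ≤ ξ x ∧ (ξ x : ℕ) < ξ q ∧ True) := by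
    intro p q
    rw [Fin.le_def, Fin.le_def, ← h, Nat.succ_le_iff]
  unfold projMargin cutMargin
  simp only [and_true] at this
  congr 1
  ext m
  simp only [Set.mem_ofPred_eq, ← and_assoc, this]

theorem cutMargin_nonneg (hξ : IsAdmissible v ξ) {k : ℕ} (hk : k + 1 < Fintype.card A) :
    0 ≤ cutMargin v ξ k :=
  (le_cutMargin_iff hk).2 fun p q hp hq => hξ p q (Fin.lt_def.2 (by omega))

theorem cutMargin_le_one (hv : IsLlull v) {k : ℕ} (hk : k + 1 < Fintype.card A) :
    cutMargin v ξ k ≤ 1 := by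
  obtain ⟨p, hp⟩ := exists_position ξ (show k < Fintype.card A by omega)
  obtain ⟨q, hq⟩ := exists_position ξ hk
  exact (cutMargin_le hp.le (by omega)).trans
    (indirectMargin_le_one hv ((position_ne (ξ := ξ) (x := p) (y := q)).1 (by omega)))

/-- Passing to positions makes different orders comparable and puts the constraints in a form with
plain index arithmetic. Admissibility supplies the sign of the margins. -/
theorem isFeasible_iff (hξ : IsAdmissible v ξ) :
    IsFeasible v ξ τ ↔ (∀ x y, τ x y = τ y x) ∧
      IsStaircase (Fintype.card A) (cutMargin v ξ) (posMatrix ξ τ) := by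
  refine and_congr_right fun hsymm => ⟨fun h => ?_, fun h x x' hx => ?_⟩
  · have hpair : ∀ i, i + 1 < Fintype.card A → ∃ x x', (ξ x : ℕ) = i ∧ (ξ x' : ℕ) = i + 1 ∧
        Next ξ x x' := by
      intro i hi
      obtain ⟨x, hx⟩ := exists_position ξ (show i < Fintype.card A by omega)
      obtain ⟨x', hx'⟩ := exists_position ξ hi
      exact ⟨x, x', hx, hx', by rw [Next, hx, hx']⟩
    refine ⟨posMatrix_symm hsymm, fun i hi => cutMargin_nonneg hξ hi, fun i hi => ?_,
      fun i hi => ?_, fun i k hi hk hki hki' => ?_⟩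
    · obtain ⟨x, x', hx, hx', hn⟩ := hpair i hi
      rw [← hx', ← hx, posMatrix_apply, ← projMargin_eq hn]
      exact (h x x' hn).1
    · obtain ⟨x, x', hx, hx', hn⟩ := hpair i hi
      rw [← hx', ← hx, posMatrix_apply]
      exact (h x x' hn).2.1
    · obtain ⟨x, x', hx, hx', hn⟩ := hpair i hi
      obtain ⟨z, rfl⟩ := exists_position ξ hk
      rw [← hx', ← hx, posMatrix_apply, posMatrix_apply, ← projMargin_eq hn]
      exact (h x x' hn).2.2 z (position_ne.1 (hx ▸ hki)) (position_ne.1 (hx' ▸ hki'))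
  · have hx1 : (ξ x : ℕ) + 1 = ξ x' := hx
    have hlt : (ξ x : ℕ) + 1 < Fintype.card A := hx1 ▸ (ξ x').2
    have h1 := h.margin_le _ hlt
    have h2 := h.le_one _ hlt
    rw [hx1, posMatrix_apply] at h1 h2
    rw [projMargin_eq hx]
    refine ⟨h1, h2, fun z hz hz' => ?_⟩
    have h3 := h.step _ (ξ z) hlt (ξ z).2 (position_ne.2 hz) (hx1 ▸ position_ne.2 hz')
    rwa [hx1, posMatrix_apply, posMatrix_apply] at h3

/-- `π` is given by the extremes of the unions of the intervals between consecutive positions. -/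
def IsProjScores (ξ : A ≃ Fin (Fintype.card A)) (M : ℕ → ℝ) (T : ℕ → ℕ → ℝ)
    (π : A → A → ℝ) : Prop :=
  ∀ x y, ξ x < ξ y → IsGreatest (upperEnd M T '' Set.Ico (ξ x : ℕ) (ξ y)) (π x y) ∧
    IsLeast (lowerEnd M T '' Set.Ico (ξ x : ℕ) (ξ y)) (π y x)

theorem mem_scoreInterval {x y : A} {s : ℝ} :
    s ∈ scoreInterval v ξ τ x y ↔ ∃ k, (ξ x : ℕ) ≤ k ∧ k < (ξ y : ℕ) ∧
      lowerEnd (cutMargin v ξ) (posMatrix ξ τ) k ≤ s ∧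
      s ≤ upperEnd (cutMargin v ξ) (posMatrix ξ τ) k := by
  have ends : ∀ p p', Next ξ p p' →
      lowerEnd (cutMargin v ξ) (posMatrix ξ τ) (ξ p) = (τ p p' - projMargin v ξ p p') / 2 ∧
      upperEnd (cutMargin v ξ) (posMatrix ξ τ) (ξ p) = (τ p p' + projMargin v ξ p p') / 2 := by
    intro p p' hp
    rw [lowerEnd, upperEnd, projMargin_eq hp, show (ξ p : ℕ) + 1 = ξ p' from hp, posMatrix_apply]
    exact ⟨rfl, rfl⟩
  constructor
  · rintro ⟨p, p', hn, hp, hp', h1, h2⟩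
    have hn' : (ξ p : ℕ) + 1 = ξ p' := hn
    rw [Fin.le_def] at hp hp'
    exact ⟨ξ p, hp, by omega, by rwa [(ends p p' hn).1], by rwa [(ends p p' hn).2]⟩
  · rintro ⟨k, hk, hk', h1, h2⟩
    have := (ξ y).2
    obtain ⟨p, rfl⟩ := exists_position ξ (show k < Fintype.card A by omega)
    obtain ⟨p', hp'⟩ := exists_position ξ (show (ξ p : ℕ) + 1 < Fintype.card A by omega)
    have hn : Next ξ p p' := hp'.symm
    rw [(ends p p' hn).1] at h1
    rw [(ends p p' hn).2] at h2
    exact ⟨p, p', hn, hk, Fin.le_def.2 (by omega), h1, h2⟩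

theorem isProjScores_iff
    (h : IsStaircase (Fintype.card A) (cutMargin v ξ) (posMatrix ξ τ)) :
    IsProjScores ξ (cutMargin v ξ) (posMatrix ξ τ) π ↔ ∀ x y, ξ x < ξ y →
      IsGreatest (scoreInterval v ξ τ x y) (π x y) ∧ IsLeast (scoreInterval v ξ τ x y) (π y x) := by
  refine forall₂_congr fun x y => imp_congr_right fun _ => ?_
  have hle : ∀ k, k < (ξ y : ℕ) → lowerEnd (cutMargin v ξ) (posMatrix ξ τ) k ≤
      upperEnd (cutMargin v ξ) (posMatrix ξ τ) k := fun k hk =>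
    h.lowerEnd_le_upperEnd (by have := (ξ y).2; omega)
  refine and_congr ⟨?_, ?_⟩ ⟨?_, ?_⟩
  · rintro ⟨⟨k, hk, he⟩, hub⟩
    refine ⟨mem_scoreInterval.2 ⟨k, hk.1, hk.2, he ▸ hle k hk.2, he.ge⟩, fun s hs => ?_⟩
    obtain ⟨m, h1, h2, -, h3⟩ := mem_scoreInterval.1 hs
    exact h3.trans (hub ⟨m, ⟨h1, h2⟩, rfl⟩)
  · rintro ⟨hm, hub⟩
    have hub' : ∀ k, (ξ x : ℕ) ≤ k → k < (ξ y : ℕ) →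
        upperEnd (cutMargin v ξ) (posMatrix ξ τ) k ≤ π x y := fun k h1 h2 =>
      hub (mem_scoreInterval.2 ⟨k, h1, h2, hle k h2, le_rfl⟩)
    obtain ⟨k, h1, h2, -, h3⟩ := mem_scoreInterval.1 hm
    refine ⟨⟨k, ⟨h1, h2⟩, le_antisymm (hub' k h1 h2) h3⟩, ?_⟩
    rintro _ ⟨m, hm, rfl⟩
    exact hub' m hm.1 hm.2
  · rintro ⟨⟨k, hk, he⟩, hlb⟩
    refine ⟨mem_scoreInterval.2 ⟨k, hk.1, hk.2, he.le, he ▸ hle k hk.2⟩, fun s hs => ?_⟩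
    obtain ⟨m, h1, h2, h3, -⟩ := mem_scoreInterval.1 hs
    exact (hlb ⟨m, ⟨h1, h2⟩, rfl⟩).trans h3
  · rintro ⟨hm, hlb⟩
    have hlb' : ∀ k, (ξ x : ℕ) ≤ k → k < (ξ y : ℕ) →
        π y x ≤ lowerEnd (cutMargin v ξ) (posMatrix ξ τ) k := fun k h1 h2 =>
      hlb (mem_scoreInterval.2 ⟨k, h1, h2, le_rfl, hle k h2⟩)
    obtain ⟨k, h1, h2, h3, -⟩ := mem_scoreInterval.1 hm
    refine ⟨⟨k, ⟨h1, h2⟩, le_antisymm h3 (hlb' k h1 h2)⟩, ?_⟩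
    rintro _ ⟨m, hm, rfl⟩
    exact hlb' m hm.1 hm.2

theorem isCLCProjection_iff [DecidableEq A] : IsCLCProjection v π ↔
    ∃ ξ, IsAdmissible v ξ ∧ ∃ τ, IsProjTurnout v ξ τ ∧
      IsProjScores ξ (cutMargin v ξ) (posMatrix ξ τ) π := by
  refine exists_congr fun ξ => and_congr_right fun hξ => exists_congr fun τ =>
    and_congr_right fun hτ => (isProjScores_iff ((isFeasible_iff hξ).1 hτ.1).2).symm

theorem exists_isProjScores (ξ : A ≃ Fin (Fintype.card A)) (M : ℕ → ℝ) (T : ℕ → ℕ → ℝ) :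
    ∃ π, IsProjScores ξ M T π := by
  have key : ∀ x y : A, ∃ a b, ξ x < ξ y →
      IsGreatest (upperEnd M T '' Set.Ico (ξ x : ℕ) (ξ y)) a ∧
      IsLeast (lowerEnd M T '' Set.Ico (ξ x : ℕ) (ξ y)) b := by
    intro x y
    by_cases hxy : ξ x < ξ y
    · have hne : (Set.Ico (ξ x : ℕ) (ξ y)).Nonempty := ⟨ξ x, le_rfl, hxy⟩
      have hfin := Set.finite_Ico (ξ x : ℕ) (ξ y)
      obtain ⟨i, hi, hi'⟩ := hfin.exists_maximalFor (upperEnd M T) _ hne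
      obtain ⟨j, hj, hj'⟩ := hfin.exists_minimalFor (lowerEnd M T) _ hne
      refine ⟨upperEnd M T i, lowerEnd M T j, fun _ => ⟨⟨⟨i, hi, rfl⟩, ?_⟩, ⟨⟨j, hj, rfl⟩, ?_⟩⟩⟩
      · rintro _ ⟨k, hk, rfl⟩
        exact (le_total _ _).elim id (hi' hk)
      · rintro _ ⟨k, hk, rfl⟩
        exact (le_total _ _).elim id (hj' hk)
    · exact ⟨0, 0, fun h => absurd h hxy⟩
  choose a b hab using key
  refine ⟨fun x y => if ξ x < ξ y then a x y else b y x, fun x y hxy => ?_⟩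
  simp only [if_pos hxy, if_neg hxy.le.not_gt]
  exact hab x y hxy

/-! ### Independence of the admissible order -/

/-- Both initial segments have the same number of elements, so if they differ, each contains an
option that the other lacks. -/
theorem initial_eq_or_crossing (ξ η : A ≃ Fin (Fintype.card A)) (k : ℕ) :
    (∀ x, (ξ x : ℕ) ≤ k ↔ (η x : ℕ) ≤ k) ∨
      ∃ a b, (ξ a : ℕ) ≤ k ∧ k < (η a : ℕ) ∧ (η b : ℕ) ≤ k ∧ k < (ξ b : ℕ) := by
  classical
  have hcard : ∀ ζ : A ≃ Fin (Fintype.card A),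
      (Finset.univ.filter fun x => (ζ x : ℕ) ≤ k).card =
        (Finset.univ.filter fun i : Fin (Fintype.card A) => (i : ℕ) ≤ k).card := fun ζ =>
    Finset.card_equiv ζ fun x => by simp
  by_contra! hcon
  obtain ⟨⟨z, hz⟩, h⟩ := hcon
  have hall : ∀ x, (ξ x : ℕ) ≤ k ↔ (η x : ℕ) ≤ k := by
    by_cases ha : ∃ a, (ξ a : ℕ) ≤ k ∧ k < (η a : ℕ)
    · obtain ⟨a, ha1, ha2⟩ := ha
      have hsub : (Finset.univ.filter fun x => (η x : ℕ) ≤ k) ⊆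
          Finset.univ.filter fun x => (ξ x : ℕ) ≤ k := fun b hb => by
        simp only [Finset.mem_filter, Finset.mem_univ, true_and] at hb ⊢
        exact h a b ha1 ha2 hb
      have heq := Finset.eq_of_subset_of_card_le hsub (by rw [hcard, hcard])
      intro x
      simpa using (Finset.ext_iff.1 heq x).symm
    · push Not at ha
      have hsub : (Finset.univ.filter fun x => (ξ x : ℕ) ≤ k) ⊆
          Finset.univ.filter fun x => (η x : ℕ) ≤ k := fun b hb => by
        simp only [Finset.mem_filter, Finset.mem_univ, true_and] at hb ⊢
        exact ha b hb
      have heq := Finset.eq_of_subset_of_card_le hsub (by rw [hcard, hcard])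
      intro x
      simpa using Finset.ext_iff.1 heq x
  have := hall z
  omega

/-- The options `a` and `b` are ranked oppositely by two admissible orders, so the margin of `a`
over `b` is zero, and this pair straddles the cut. -/
theorem cutMargin_eq_zero_of_crossing (hξ : IsAdmissible v ξ) (hη : IsAdmissible v η) {k : ℕ}
    (hk : k + 1 < Fintype.card A) {a b : A} (h1 : (ξ a : ℕ) ≤ k) (h2 : k < (η a : ℕ))
    (h3 : (η b : ℕ) ≤ k) (h4 : k < (ξ b : ℕ)) : cutMargin v ξ k = 0 := by
  have h5 := hη b a (Fin.lt_def.2 (by omega))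
  rw [indirectMargin_neg] at h5
  have h6 := cutMargin_le (v := v) h1 h4
  exact le_antisymm (by linarith) (cutMargin_nonneg hξ hk)

theorem cutMargin_congr (hξ : IsAdmissible v ξ) (hη : IsAdmissible v η) {k : ℕ}
    (hk : k + 1 < Fintype.card A) : cutMargin v ξ k = cutMargin v η k := by
  rcases initial_eq_or_crossing ξ η k with h | ⟨a, b, h1, h2, h3, h4⟩
  · unfold cutMargin
    simp_rw [h, ← not_le, h]
  · rw [cutMargin_eq_zero_of_crossing hξ hη hk h1 h2 h3 h4,
      cutMargin_eq_zero_of_crossing hη hξ hk h3 h4 h1 h2]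

/-- A cut between the two positions of `x` separates different initial segments in the two orders,
hence is crossed. -/
theorem tied_position (hξ : IsAdmissible v ξ) (hη : IsAdmissible v η) (x : A) :
    Tied (cutMargin v ξ) (ξ x) (η x) := by
  intro k hk
  have := (ξ x).2
  have := (η x).2
  rcases initial_eq_or_crossing ξ η k with h | ⟨a, b, h1, h2, h3, h4⟩
  · have := h x
    omega
  · exact cutMargin_eq_zero_of_crossing hξ hη (by omega) h1 h2 h3 h4

theorem posMatrix_congr (hξ : IsAdmissible v ξ) (hη : IsAdmissible v η)
    (h : IsStaircase (Fintype.card A) (cutMargin v ξ) (posMatrix ξ τ)) {i j : ℕ} (hij : i ≠ j)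
    (hi : i < Fintype.card A) (hj : j < Fintype.card A) :
    posMatrix η τ i j = posMatrix ξ τ i j := by
  obtain ⟨x, rfl⟩ := exists_position η hi
  obtain ⟨y, rfl⟩ := exists_position η hj
  rw [posMatrix_apply, ← posMatrix_apply (ξ := ξ) (τ := τ)]
  exact h.eq_of_tied_of_tied (ξ x).2 (ξ y).2 hi hj (position_ne.2 (position_ne.1 hij)) hij
    (tied_position hξ hη x) (tied_position hξ hη y)

/-- Feasibility is thus the same condition for all admissible orders. As the deviation never
mentions the order, the closest point is the same too. -/
theorem isFeasible_of_isFeasible (hξ : IsAdmissible v ξ) (hη : IsAdmissible v η)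
    (h : IsFeasible v ξ τ) : IsFeasible v η τ := by
  obtain ⟨hs, h⟩ := (isFeasible_iff hξ).1 h
  refine (isFeasible_iff hη).2 ⟨hs, posMatrix_symm hs, fun i hi => cutMargin_nonneg hη hi,
    fun i hi => ?_, fun i hi => ?_, fun i k hi hk hki hki' => ?_⟩
  · rw [posMatrix_congr hξ hη h (by omega) (by omega) hi, ← cutMargin_congr hξ hη hi]
    exact h.margin_le i hi
  · rw [posMatrix_congr hξ hη h (by omega) (by omega) hi]
    exact h.le_one i hi
  · rw [posMatrix_congr hξ hη h hki.symm (by omega) hk, posMatrix_congr hξ hη h hki'.symm hi hk,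
      ← cutMargin_congr hξ hη hi]
    exact h.step i k hi hk hki hki'

theorem isProjScores_congr {M M' : ℕ → ℝ} {T T' : ℕ → ℕ → ℝ}
    (hM : ∀ k, k + 1 < Fintype.card A → M k = M' k)
    (hT : ∀ k, k + 1 < Fintype.card A → T k (k + 1) = T' k (k + 1)) :
    IsProjScores ξ M T π ↔ IsProjScores ξ M' T' π := by
  refine forall₂_congr fun x y => imp_congr_right fun _ => ?_
  have := (ξ y).2
  rw [Set.image_congr (f := upperEnd M T) (g := upperEnd M' T') fun k hk => ?_,
    Set.image_congr (f := lowerEnd M T) (g := lowerEnd M' T') fun k hk => ?_]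
  · rw [lowerEnd, lowerEnd, hM k (by have := hk.2; omega), hT k (by have := hk.2; omega)]
  · rw [upperEnd, upperEnd, hM k (by have := hk.2; omega), hT k (by have := hk.2; omega)]

theorem isProjScores_unique {M : ℕ → ℝ} {T : ℕ → ℕ → ℝ} {π' : A → A → ℝ}
    (h : IsStaircase (Fintype.card A) M T) (ht : ∀ x, Tied M (ξ x) (η x))
    (hπ : IsProjScores ξ M T π) (hπ' : IsProjScores η M T π') {x y : A} (hxy : x ≠ y) :
    π x y = π' x y := by
  have ht' : ∀ x, Tied M (η x) (ξ x) := fun x k hk => ht x k hk.symm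
  have main : ∀ x y, ξ x < ξ y → π x y = π' x y ∧ π y x = π' y x := by
    intro x y hlt
    have hne : x ≠ y := by
      rintro rfl
      exact lt_irrefl _ hlt
    obtain ⟨⟨⟨a, ha, ha'⟩, hau⟩, ⟨⟨b, hb, hb'⟩, hbl⟩⟩ := hπ x y hlt
    rcases lt_or_gt_of_ne (fun e => hne (η.injective e) : η x ≠ η y) with hlt' | hlt'
    · obtain ⟨⟨⟨c, hc, hc'⟩, hcu⟩, ⟨⟨d, hd, hd'⟩, hdl⟩⟩ := hπ' x y hlt'
      constructor
      · obtain ⟨k, h1, h2, h3, -⟩ := h.exists_wider_of_tied (ξ y).2 (η y).2 hlt' (ht x) (ht y)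
          ha.1 ha.2
        obtain ⟨m, h4, h5, h6, -⟩ := h.exists_wider_of_tied (η y).2 (ξ y).2 hlt (ht' x) (ht' y)
          hc.1 hc.2
        have h7 := hcu ⟨k, ⟨h1, h2⟩, rfl⟩
        have h8 := hau ⟨m, ⟨h4, h5⟩, rfl⟩
        linarith
      · obtain ⟨k, h1, h2, -, h3⟩ := h.exists_wider_of_tied (ξ y).2 (η y).2 hlt' (ht x) (ht y)
          hb.1 hb.2
        obtain ⟨m, h4, h5, -, h6⟩ := h.exists_wider_of_tied (η y).2 (ξ y).2 hlt (ht' x) (ht' y)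
          hd.1 hd.2
        have h7 := hdl ⟨k, ⟨h1, h2⟩, rfl⟩
        have h8 := hbl ⟨m, ⟨h4, h5⟩, rfl⟩
        linarith
    · obtain ⟨⟨⟨c, hc, hc'⟩, -⟩, ⟨⟨d, hd, hd'⟩, -⟩⟩ := hπ' y x hlt'
      constructor
      · rw [← ha', ← hd']
        exact (h.ends_eq_of_tied_of_crossing (ξ y).2 (η x).2 (ht x) (ht y) ha.1 ha.2 hd.1 hd.2).1
      · rw [← hb', ← hc']
        exact (h.ends_eq_of_tied_of_crossing (ξ y).2 (η x).2 (ht x) (ht y) hb.1 hb.2 hc.1 hc.2).2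
  rcases lt_or_gt_of_ne (fun e => hxy (ξ.injective e) : ξ x ≠ ξ y) with hlt | hlt
  · exact (main x y hlt).1
  · exact (main y x hlt).2

end Order

/-! ### Existence and uniqueness of the projection -/

section Turnout

variable {A : Type*} [Fintype A] {v π : A → A → ℝ} {τ τ' : A → A → ℝ}
  {ξ η : A ≃ Fin (Fintype.card A)}

theorem Next.ne {x x' : A} (h : Next ξ x x') : x ≠ x' := by
  rintro rfl
  unfold Next at h
  omega

theorem isFeasible_congr (h : ∀ x y, x ≠ y → τ x y = τ' x y) (hτ : IsFeasible v ξ τ) :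
    IsFeasible v ξ τ' := by
  refine ⟨fun x y => ?_, fun x x' hx => ?_⟩
  · rcases eq_or_ne x y with rfl | hxy
    · rfl
    · rw [← h x y hxy, ← h y x hxy.symm, hτ.1]
  · obtain ⟨h1, h2, h3⟩ := hτ.2 x x' hx
    rw [← h x x' hx.ne]
    refine ⟨h1, h2, fun z hz hz' => ?_⟩
    rw [← h x z hz.symm, ← h x' z hz'.symm]
    exact h3 z hz hz'

theorem isFeasible_const (hξ : IsAdmissible v ξ) {c : ℝ} (hc : c ≤ 1)
    (hM : ∀ k, k + 1 < Fintype.card A → cutMargin v ξ k ≤ c) :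
    IsFeasible v ξ fun _ _ => c := by
  refine ⟨fun _ _ => rfl, fun x x' hx => ?_⟩
  have hlt : (ξ x : ℕ) + 1 < Fintype.card A := by
    rw [show (ξ x : ℕ) + 1 = ξ x' from hx]
    exact (ξ x').2
  rw [projMargin_eq hx]
  refine ⟨hM _ hlt, hc, fun z _ _ => ?_⟩
  rw [sub_self]
  exact ⟨le_rfl, cutMargin_nonneg hξ hlt⟩

theorem isClosed_isFeasible (v : A → A → ℝ) (ξ : A ≃ Fin (Fintype.card A)) :
    IsClosed {τ : A → A → ℝ | IsFeasible v ξ τ} := by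
  have hc : ∀ x y : A, Continuous fun τ : A → A → ℝ => τ x y := fun x y => by fun_prop
  simp only [IsFeasible, Set.ofPred_and, Set.ofPred_forall]
  refine (isClosed_iInter fun x => isClosed_iInter fun y => isClosed_eq (hc x y) (hc y x)).inter
    (isClosed_iInter fun x => isClosed_iInter fun x' => isClosed_iInter fun _ => ?_)
  refine (isClosed_le continuous_const (hc x x')).inter
    ((isClosed_le (hc x x') continuous_const).inter
      (isClosed_iInter fun z => isClosed_iInter fun _ => isClosed_iInter fun _ => ?_))
  exact (isClosed_le continuous_const ((hc x z).sub (hc x' z))).inter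
    (isClosed_le ((hc x z).sub (hc x' z)) continuous_const)

variable [DecidableEq A]

theorem deviation_congr (h : ∀ x y, x ≠ y → τ x y = τ' x y) : deviation v τ = deviation v τ' :=
  Finset.sum_congr rfl fun x _ => Finset.sum_congr rfl fun y hy => by
    rw [h x y (Finset.ne_of_mem_erase hy).symm]

theorem deviation_nonneg (v τ : A → A → ℝ) : 0 ≤ deviation v τ :=
  Finset.sum_nonneg fun _ _ => Finset.sum_nonneg fun _ _ => sq_nonneg _

theorem exists_isProjTurnout (hv : IsLlull v) (hξ : IsAdmissible v ξ) :
    ∃ τ, IsProjTurnout v ξ τ := by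
  have hK : IsCompact ({τ : A → A → ℝ | IsFeasible v ξ τ} ∩ Set.Icc 0 1) :=
    isCompact_Icc.inter_left (isClosed_isFeasible v ξ)
  have hne : ({τ : A → A → ℝ | IsFeasible v ξ τ} ∩ Set.Icc 0 1).Nonempty :=
    ⟨fun _ _ => 1, isFeasible_const hξ le_rfl fun _ hk => cutMargin_le_one hv hk,
      fun _ _ => zero_le_one, fun _ _ => le_rfl⟩
  have hcont : Continuous (deviation v) := by
    unfold deviation
    fun_prop
  obtain ⟨τ, hτ, hmin⟩ := hK.exists_isMinOn hne hcont.continuousOn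
  refine ⟨τ, hτ.1, fun τ' hτ' => ?_⟩
  -- Feasibility and deviation ignore the diagonal, which is therefore unbounded. Setting it to zero
  -- brings any competitor into the compact cube.
  have hoff : ∀ x y, x ≠ y → τ' x y = (fun x y => if x = y then 0 else τ' x y) x y :=
    fun x y h => (if_neg h).symm
  rw [deviation_congr (v := v) hoff]
  have hst := ((isFeasible_iff hξ).1 hτ').2
  have hbd : ∀ x y, x ≠ y → 0 ≤ τ' x y ∧ τ' x y ≤ 1 := fun x y hxy => by
    rw [← posMatrix_apply (ξ := ξ) (τ := τ')]
    exact hst.mem_unit (position_ne.2 hxy) (ξ x).2 (ξ y).2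
  refine hmin ⟨isFeasible_congr hoff hτ', fun x y => ?_, fun x y => ?_⟩
  · show 0 ≤ if x = y then 0 else τ' x y
    split_ifs with h
    · exact le_rfl
    · exact (hbd x y h).1
  · show (if x = y then 0 else τ' x y) ≤ 1
    split_ifs with h
    · exact zero_le_one
    · exact (hbd x y h).2

/-- Convexity of the constraints and the parallelogram identity, applied to the midpoint of two
closest points. -/
theorem IsProjTurnout.unique (h : IsProjTurnout v ξ τ) (h' : IsProjTurnout v ξ τ') {x y : A}
    (hxy : x ≠ y) : τ x y = τ' x y := by
  have hmid : IsFeasible v ξ fun x y => (τ x y + τ' x y) / 2 := by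
    refine ⟨fun x y => ?_, fun x x' hx => ?_⟩
    · show (τ x y + τ' x y) / 2 = (τ y x + τ' y x) / 2
      rw [h.1.1 x y, h'.1.1 x y]
    obtain ⟨h1, h2, h3⟩ := h.1.2 x x' hx
    obtain ⟨h4, h5, h6⟩ := h'.1.2 x x' hx
    refine ⟨by linarith, by linarith, fun z hz hz' => ?_⟩
    obtain ⟨h7, h8⟩ := h3 z hz hz'
    obtain ⟨h9, h10⟩ := h6 z hz hz'
    constructor <;> linarith
  have hsum : ∑ x, ∑ y ∈ Finset.univ.erase x, (τ x y - τ' x y) ^ 2 =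
      2 * deviation v τ + 2 * deviation v τ' -
        4 * deviation v fun x y => (τ x y + τ' x y) / 2 := by
    simp only [deviation, Finset.mul_sum, ← Finset.sum_add_distrib, ← Finset.sum_sub_distrib]
    refine Finset.sum_congr rfl fun x _ => Finset.sum_congr rfl fun y _ => ?_
    ring
  have h1 := h.2 _ hmid
  have h2 := h'.2 _ hmid
  have hle := hsum.trans_le (show _ ≤ (0 : ℝ) by linarith)
  have hzero := (Finset.sum_eq_zero_iff_of_nonneg fun x _ =>
    Finset.sum_nonneg fun y _ => sq_nonneg (τ x y - τ' x y)).1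
    (le_antisymm hle (Finset.sum_nonneg fun x _ => Finset.sum_nonneg fun y _ => sq_nonneg _))
    x (Finset.mem_univ x)
  have := (Finset.sum_eq_zero_iff_of_nonneg fun y _ => sq_nonneg (τ x y - τ' x y)).1 hzero y
    (Finset.mem_erase.2 ⟨hxy.symm, Finset.mem_univ y⟩)
  exact sub_eq_zero.1 (pow_eq_zero_iff two_ne_zero |>.1 this)

theorem exists_isCLCProjection (hv : IsLlull v) : ∃ π, IsCLCProjection v π := by
  obtain ⟨ξ, hξ⟩ := exists_isAdmissible v
  obtain ⟨τ, hτ⟩ := exists_isProjTurnout hv hξ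
  obtain ⟨π, hπ⟩ := exists_isProjScores ξ (cutMargin v ξ) (posMatrix ξ τ)
  exact ⟨π, isCLCProjection_iff.2 ⟨ξ, hξ, τ, hτ, hπ⟩⟩

theorem IsCLCProjection.unique {π' : A → A → ℝ} (h : IsCLCProjection v π)
    (h' : IsCLCProjection v π') {x y : A} (hxy : x ≠ y) : π x y = π' x y := by
  obtain ⟨ξ, hξ, τ, hτ, hπ⟩ := isCLCProjection_iff.1 h
  obtain ⟨η, hη, τ', hτ', hπ'⟩ := isCLCProjection_iff.1 h'
  have hτ2 : IsProjTurnout v ξ τ' := ⟨isFeasible_of_isFeasible hη hξ hτ'.1, fun σ hσ =>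
    hτ'.2 σ (isFeasible_of_isFeasible hξ hη hσ)⟩
  have hst := ((isFeasible_iff hξ).1 hτ.1).2
  have hst' := ((isFeasible_iff hη).1 hτ'.1).2
  refine isProjScores_unique (η := η) hst (tied_position hξ hη) hπ ?_ hxy
  refine (isProjScores_congr (fun k hk => cutMargin_congr hη hξ hk) fun k hk => ?_).1 hπ'
  rw [← posMatrix_congr hη hξ hst' (by omega) (by omega) hk]
  obtain ⟨a, ha⟩ := exists_position ξ (show k < Fintype.card A by omega)
  obtain ⟨b, hb⟩ := exists_position ξ hk
  rw [← hb, ← ha, posMatrix_apply, posMatrix_apply]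
  exact hτ2.unique hτ ((position_ne (ξ := ξ) (x := a) (y := b)).1 (by omega))

theorem IsCLCProjection.nonneg (h : IsCLCProjection v π) {x y : A} (hxy : x ≠ y) : 0 ≤ π x y := by
  obtain ⟨ξ, hξ, τ, hτ, hπ⟩ := isCLCProjection_iff.1 h
  have hst := ((isFeasible_iff hξ).1 hτ.1).2
  have hx := (ξ x).2
  have hy := (ξ y).2
  rcases lt_or_gt_of_ne (fun e => hxy (ξ.injective e) : ξ x ≠ ξ y) with hlt | hlt
  · obtain ⟨k, hk, he⟩ := (hπ x y hlt).1.1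
    rw [← he]
    have hk' : k + 1 < Fintype.card A := by have := hk.2; omega
    exact (hst.lowerEnd_nonneg hk').trans (hst.lowerEnd_le_upperEnd hk')
  · obtain ⟨k, hk, he⟩ := (hπ y x hlt).2.1
    rw [← he]
    exact hst.lowerEnd_nonneg (by have := hk.2; omega)

/-! ### The top class of the projection -/

/-- The options that precede every vanishing lower end. -/
noncomputable def topClass (ξ : A ≃ Fin (Fintype.card A)) (l : ℕ → ℝ) : Finset A :=
  open Classical in Finset.univ.filter fun x => ∀ k, k < (ξ x : ℕ) → 0 < l k

omit [DecidableEq A] in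
theorem mem_topClass {l : ℕ → ℝ} {x : A} :
    x ∈ topClass ξ l ↔ ∀ k, k < (ξ x : ℕ) → 0 < l k := by
  simp [topClass]

/-- If the topmost interval reduces to zero, so do all the scores. -/
theorem eq_zero_of_upperEnd_eq_zero (hv : IsLlull v) (hξ : IsAdmissible v ξ)
    (hτ : IsProjTurnout v ξ τ) (hcard : 1 < Fintype.card A)
    (h0 : upperEnd (cutMargin v ξ) (posMatrix ξ τ) 0 = 0) {x y : A} (hxy : x ≠ y) :
    v x y = 0 := by
  have hst := ((isFeasible_iff hξ).1 hτ.1).2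
  have hT0 : posMatrix ξ τ 0 1 ≤ 0 := by
    have := hst.margin_nonneg 0 hcard
    unfold upperEnd at h0
    rw [zero_add] at h0
    linarith
  have hT : ∀ k, k + 1 < Fintype.card A → posMatrix ξ τ k (k + 1) ≤ 0 := fun k hk => by
    have := (hst.consecutive_sub_mem (Nat.zero_le k) hk).1
    rw [zero_add] at this
    linarith
  have hτ0 : ∀ x y, x ≠ y → τ x y = 0 := by
    have : ∀ x y, ξ x < ξ y → τ x y = 0 := fun x y hlt => by
      rw [← posMatrix_apply (ξ := ξ) (τ := τ)]
      have hy := (ξ y).2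
      exact le_antisymm ((hst.le_consecutive hlt hy).trans (hT _ (by omega)))
        (hst.nonneg_of_lt hlt hy)
    intro x y hxy
    rcases lt_or_gt_of_ne (fun e => hxy (ξ.injective e) : ξ x ≠ ξ y) with hlt | hlt
    · exact this x y hlt
    · rw [hτ.1.1, this y x hlt]
  -- Here `τ` vanishes off the diagonal. Against a constant competitor `c` the deviation changes by
  -- `c² W - 2 c S`, which is least at `c = S / W` with value `-S² / W`. That constant is feasible
  -- since no margin is positive, so `S` must vanish.
  have hdev : ∀ c : ℝ, deviation v (fun _ _ => c) = deviation v τ +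
      c ^ 2 * ∑ x : A, ∑ y ∈ Finset.univ.erase x, (1 : ℝ) -
        2 * c * ∑ x, ∑ y ∈ Finset.univ.erase x, turnout v x y := by
    intro c
    rw [deviation, deviation, Finset.mul_sum, Finset.mul_sum, ← Finset.sum_add_distrib,
      ← Finset.sum_sub_distrib]
    refine Finset.sum_congr rfl fun x _ => ?_
    rw [Finset.mul_sum, Finset.mul_sum, ← Finset.sum_add_distrib, ← Finset.sum_sub_distrib]
    refine Finset.sum_congr rfl fun y hy => ?_
    rw [hτ0 x y (Finset.ne_of_mem_erase hy).symm]
    ring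
  have key : ∀ s t : ℝ, 0 < t → (s / t) ^ 2 * t - 2 * (s / t) * s = -(s ^ 2 / t) := by
    intro s t ht
    field_simp
    ring
  set W := ∑ x : A, ∑ y ∈ Finset.univ.erase x, (1 : ℝ)
  set S := ∑ x, ∑ y ∈ Finset.univ.erase x, turnout v x y
  have ht : ∀ x, ∀ y ∈ Finset.univ.erase x, 0 ≤ turnout v x y := fun x y hy => by
    have hne := (Finset.ne_of_mem_erase hy).symm
    exact add_nonneg (hv x y hne).1 (hv y x hne.symm).1
  have hS0 : 0 ≤ S := Finset.sum_nonneg fun x _ => Finset.sum_nonneg (ht x)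
  have hSW : S ≤ W := Finset.sum_le_sum fun x _ => Finset.sum_le_sum fun y hy =>
    (hv x y (Finset.ne_of_mem_erase hy).symm).2.2
  have hS : S = 0 := by
    refine le_antisymm ?_ hS0
    by_contra! hpos
    have hW : 0 < W := hpos.trans_le hSW
    have hfeas : IsFeasible v ξ fun _ _ => S / W :=
      isFeasible_const hξ ((div_le_one hW).2 hSW) fun k hk =>
        (hst.margin_le k hk).trans ((hT k hk).trans (div_nonneg hS0 hW.le))
    have h1 := hτ.2 _ hfeas
    rw [hdev] at h1
    have h2 := key S W hW
    have h3 : 0 < S ^ 2 / W := div_pos (pow_pos hpos 2) hW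
    linarith
  have h1 := (Finset.sum_eq_zero_iff_of_nonneg fun x _ => Finset.sum_nonneg (ht x)).1 hS x
    (Finset.mem_univ x)
  have h2 := (Finset.sum_eq_zero_iff_of_nonneg (ht x)).1 h1 y
    (Finset.mem_erase.2 ⟨hxy.symm, Finset.mem_univ y⟩)
  unfold turnout at h2
  linarith [(hv x y hxy).1, (hv y x hxy.symm).1]

/-- Below the first position, the interval overlaps the preceding one, whose lower end is positive.
At the first position a zero upper end would make all scores vanish. -/
theorem upperEnd_pos_of_mem_topClass (hv : IsLlull v) (hne : ∃ x y, x ≠ y ∧ v x y ≠ 0)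
    (hξ : IsAdmissible v ξ) (hτ : IsProjTurnout v ξ τ) {x : A}
    (hx : x ∈ topClass ξ (lowerEnd (cutMargin v ξ) (posMatrix ξ τ)))
    (hlt : (ξ x : ℕ) + 1 < Fintype.card A) :
    0 < upperEnd (cutMargin v ξ) (posMatrix ξ τ) (ξ x) := by
  have hst := ((isFeasible_iff hξ).1 hτ.1).2
  rw [mem_topClass] at hx
  rcases Nat.eq_zero_or_pos (ξ x : ℕ) with h0 | h0
  · rw [h0] at hlt ⊢
    refine ((hst.lowerEnd_nonneg hlt).trans (hst.lowerEnd_le_upperEnd hlt)).lt_of_ne fun h => ?_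
    obtain ⟨a, b, hab, hvab⟩ := hne
    exact hvab (eq_zero_of_upperEnd_eq_zero hv hξ hτ hlt h.symm hab)
  · obtain ⟨m, hm⟩ : ∃ m, (ξ x : ℕ) = m + 1 := ⟨(ξ x : ℕ) - 1, by omega⟩
    rw [hm] at hlt ⊢
    exact (hx m (by omega)).trans_le (hst.lowerEnd_le_upperEnd_succ hlt)

omit [DecidableEq A] in
theorem topClass_nonempty [Nonempty A] (ξ : A ≃ Fin (Fintype.card A)) (l : ℕ → ℝ) :
    (topClass ξ l).Nonempty := by
  obtain ⟨x, hx⟩ := exists_position ξ (Fintype.card_pos (α := A))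
  exact ⟨x, mem_topClass.2 fun k hk => by omega⟩

/-- A range leading out of the top class contains a cut with vanishing lower end, whereas a range
within it contains none. This is the dominance pattern. The set is named `X` with an equation so
that another description of it can be supplied. -/
theorem exists_isStrengths_of_isProjScores [Nonempty A] (hv : IsLlull v)
    (hne : Subsingleton A ∨ ∃ x y, x ≠ y ∧ v x y ≠ 0) (hξ : IsAdmissible v ξ)
    (hτ : IsProjTurnout v ξ τ) (hπ : IsProjScores ξ (cutMargin v ξ) (posMatrix ξ τ) π)
    {X : Finset A} (hX : X = topClass ξ (lowerEnd (cutMargin v ξ) (posMatrix ξ τ))) :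
    ∃ φ, (∀ x ∈ X, 0 < φ x) ∧ (∀ y ∉ X, φ y = 0) ∧ IsStrengths π φ ∧
      IsStrengths (fun x y : {x // x ∈ X} => π x y) (fun x => φ x) := by
  have hst := ((isFeasible_iff hξ).1 hτ.1).2
  have hclc : IsCLCProjection v π := isCLCProjection_iff.2 ⟨ξ, hξ, τ, hτ, hπ⟩
  have hout : ∀ x ∈ X, ∀ y ∉ X, ξ x < ξ y ∧ 0 < π x y ∧ π y x = 0 := by
    subst hX
    intro x hx y hy
    have hx' := mem_topClass.1 hx
    obtain ⟨k, hk, hk0⟩ : ∃ k, k < (ξ y : ℕ) ∧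
        lowerEnd (cutMargin v ξ) (posMatrix ξ τ) k ≤ 0 := by
      by_contra! h
      exact hy (mem_topClass.2 h)
    have hxk : (ξ x : ℕ) ≤ k := by
      by_contra! h
      exact absurd (hx' k h) hk0.not_gt
    have hlt : ξ x < ξ y := Fin.lt_def.2 (by omega)
    have hyA := (ξ y).2
    have hxy : x ≠ y := ne_of_mem_of_not_mem hx hy
    obtain ⟨h1, h2⟩ := hπ x y hlt
    refine ⟨hlt, ?_, le_antisymm ((h2.2 ⟨k, ⟨hxk, hk⟩, rfl⟩).trans hk0) (hclc.nonneg hxy.symm)⟩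
    refine (upperEnd_pos_of_mem_topClass hv ?_ hξ hτ hx (by omega)).trans_le
      (h1.2 ⟨ξ x, ⟨le_rfl, hlt⟩, rfl⟩)
    exact hne.resolve_left fun hs => hxy (Subsingleton.elim x y)
  refine exists_isStrengths_of_dominant (hX ▸ topClass_nonempty _ _)
    (fun x y hxy => hclc.nonneg hxy) ?_ (fun x hx y hy => (hout x hx y hy).2.1)
    fun x hx y hy => (hout x hx y hy).2.2
  subst hX
  intro x hx y hy hxy
  rw [mem_topClass] at hx hy
  have hxA := (ξ x).2
  have hyA := (ξ y).2
  rcases lt_or_gt_of_ne (fun e => hxy (ξ.injective e) : ξ x ≠ ξ y) with hlt | hlt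
  · obtain ⟨k, hk, he⟩ := (hπ x y hlt).1.1
    rw [← he]
    exact (hy k hk.2).trans_le (hst.lowerEnd_le_upperEnd (by have := hk.2; omega))
  · obtain ⟨k, hk, he⟩ := (hπ y x hlt).2.1
    rw [← he]
    exact hx k hk.2

end Turnout

/-! ### Unanimously preferred sets and the projection -/

section Preferred

variable {A : Type*} [Fintype A] {v π : A → A → ℝ} {τ : A → A → ℝ}
  {ξ : A ≃ Fin (Fintype.card A)} {X : Finset A}

/-- A unanimously preferred set is an initial segment of every admissible order. -/
theorem UnanimouslyPreferred.position_lt (hv : IsLlull v) (hξ : IsAdmissible v ξ)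
    (hX : UnanimouslyPreferred v X) {x y : A} (hx : x ∈ X) (hy : y ∉ X) : ξ x < ξ y := by
  by_contra! hle
  have hlt : ξ y < ξ x :=
    hle.lt_of_ne fun e => ne_of_mem_of_not_mem hx hy (ξ.injective e).symm
  have := hξ y x hlt
  rw [indirectMargin_neg, hX.indirectMargin_eq_one hv hx hy] at this
  linarith

theorem UnanimouslyPreferred.mem_of_le (hv : IsLlull v) (hξ : IsAdmissible v ξ)
    (hX : UnanimouslyPreferred v X) {x y : A} (hx : x ∈ X) (hyx : ξ y ≤ ξ x) : y ∈ X := by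
  by_contra hy
  exact absurd (hX.position_lt hv hξ hx hy) (not_lt.2 hyx)

/-- The cut is placed at the last position occupied by `X`. -/
theorem UnanimouslyPreferred.exists_cut (hv : IsLlull v) (hξ : IsAdmissible v ξ)
    (hX : UnanimouslyPreferred v X) (hne : X.Nonempty) (hun : X ≠ Finset.univ) :
    ∃ k, k + 1 < Fintype.card A ∧ (∀ x, x ∈ X ↔ (ξ x : ℕ) ≤ k) ∧ cutMargin v ξ k = 1 := by
  obtain ⟨x₀, hx₀, hmax⟩ := Finset.exists_max_image X ξ hne
  have hiff : ∀ x, x ∈ X ↔ (ξ x : ℕ) ≤ ξ x₀ := fun x =>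
    ⟨fun hx => hmax x hx, fun hx => hX.mem_of_le hv hξ hx₀ hx⟩
  obtain ⟨y, hy⟩ : ∃ y, y ∉ X := by
    by_contra! h
    exact hun (Finset.eq_univ_iff_forall.2 h)
  have hk : (ξ x₀ : ℕ) + 1 < Fintype.card A := by
    have h1 := (ξ y).2
    have h2 := Fin.lt_def.1 (hX.position_lt hv hξ hx₀ hy)
    omega
  refine ⟨ξ x₀, hk, hiff, le_antisymm (cutMargin_le_one hv hk) ((le_cutMargin_iff hk).2 ?_)⟩
  intro p q hp hq
  exact (hX.indirectMargin_eq_one hv ((hiff p).2 hp) fun h => absurd ((hiff q).1 h)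
    (not_le.2 hq)).ge

/-- At a cut of margin one the turnout is at most the margin, so the lower end cannot be positive.
-/
theorem UnanimouslyPreferred.topClass_subset (hv : IsLlull v) (hξ : IsAdmissible v ξ)
    (hst : IsStaircase (Fintype.card A) (cutMargin v ξ) (posMatrix ξ τ))
    (hX : UnanimouslyPreferred v X) (hne : X.Nonempty) :
    topClass ξ (lowerEnd (cutMargin v ξ) (posMatrix ξ τ)) ⊆ X := by
  by_cases hun : X = Finset.univ
  · rw [hun]
    exact Finset.subset_univ _
  obtain ⟨k, hk, hiff, hM⟩ := hX.exists_cut hv hξ hne hun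
  intro x hx
  rw [mem_topClass] at hx
  rw [hiff]
  by_contra! h
  have h1 := hx k h
  have h2 := hst.le_one k hk
  unfold lowerEnd at h1
  linarith

variable [DecidableEq A]

/-- Inside a unanimously preferred set whose pairs all have full turnout, the projected turnouts
of consecutive options equal one. -/
theorem UnanimouslyPreferred.posMatrix_eq_one (hv : IsLlull v) (hξ : IsAdmissible v ξ)
    (hτ : IsProjTurnout v ξ τ) (hX : UnanimouslyPreferred v X) (hne : X.Nonempty)
    (ht : ∀ x ∈ X, ∀ y, x ≠ y → turnout v x y = 1) {k : ℕ} (hk : k + 1 < Fintype.card A)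
    (hkX : ∀ x, (ξ x : ℕ) ≤ k + 1 → x ∈ X) : posMatrix ξ τ k (k + 1) = 1 := by
  have hst := ((isFeasible_iff hξ).1 hτ.1).2
  by_cases hun : X = Finset.univ
  · have hone : IsProjTurnout v ξ fun _ _ => 1 := by
      refine ⟨isFeasible_const hξ le_rfl fun _ hk => cutMargin_le_one hv hk, fun τ' _ => ?_⟩
      refine le_trans (le_of_eq ?_) (deviation_nonneg v τ')
      refine Finset.sum_eq_zero fun x _ => Finset.sum_eq_zero fun y hy => ?_
      rw [ht x (hun ▸ Finset.mem_univ x) y (Finset.ne_of_mem_erase hy).symm]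
      norm_num
    obtain ⟨a, ha⟩ := exists_position ξ (show k < Fintype.card A by omega)
    obtain ⟨b, hb⟩ := exists_position ξ hk
    rw [← hb, ← ha, posMatrix_apply]
    exact hτ.unique hone ((position_ne (ξ := ξ) (x := a) (y := b)).1 (by omega))
  -- Margin one behind `X` forces turnout one there, and turnouts of consecutive options do not
  -- increase along the order.
  · obtain ⟨m, hm, hiff, hM⟩ := hX.exists_cut hv hξ hne hun
    obtain ⟨b, hb⟩ := exists_position ξ hk
    have hkm := (hiff b).1 (hkX b hb.le)
    have h1 := hst.margin_le m hm
    have h2 := (hst.consecutive_sub_mem (show k ≤ m by omega) hm).1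
    have h3 := hst.le_one k hk
    linarith

/-- A vanishing lower end inside `X` means margin one, as the turnout there is one. Every reverse
score across that cut is then zero, and full turnout makes the options before the cut unanimously
preferred, against minimality. -/
theorem IsMinimalPreferred.eq_topClass (hv : IsLlull v) (hξ : IsAdmissible v ξ)
    (hτ : IsProjTurnout v ξ τ) (hX : IsMinimalPreferred v X)
    (ht : ∀ x ∈ X, ∀ y, x ≠ y → turnout v x y = 1) :
    X = topClass ξ (lowerEnd (cutMargin v ξ) (posMatrix ξ τ)) := by
  have hst := ((isFeasible_iff hξ).1 hτ.1).2
  obtain ⟨⟨hne, hun⟩, hmin⟩ := hX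
  refine Finset.Subset.antisymm (fun x hx => mem_topClass.2 fun k hk => ?_)
    (hun.topClass_subset hv hξ hst hne)
  have hxA := (ξ x).2
  have hkA : k + 1 < Fintype.card A := by omega
  have hmem : ∀ y, (ξ y : ℕ) ≤ k + 1 → y ∈ X := fun y hy =>
    hun.mem_of_le hv hξ hx (Fin.le_def.2 (by omega))
  refine (hst.lowerEnd_nonneg hkA).lt_of_ne fun h0 => ?_
  have hT := hun.posMatrix_eq_one hv hξ hτ hne ht hkA hmem
  have hM : 1 ≤ cutMargin v ξ k := by
    unfold lowerEnd at h0
    linarith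
  rw [le_cutMargin_iff hkA] at hM
  have hpre : UnanimouslyPreferred v (Finset.univ.filter fun y => (ξ y : ℕ) ≤ k) := by
    intro p hp q hq
    simp only [Finset.mem_filter, Finset.mem_univ, true_and, not_le] at hp hq
    have hpq : p ≠ q := position_ne (ξ := ξ).1 (by omega)
    have h1 := eq_zero_of_indirectMargin_eq_one hv hpq
      (le_antisymm (indirectMargin_le_one hv hpq) (hM p q hp hq))
    have h2 := ht p (hmem p (by omega)) q hpq
    unfold turnout at h2
    linarith
  obtain ⟨a, ha⟩ := exists_position ξ (show k < Fintype.card A by omega)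
  have hle := hmin ⟨⟨a, by simp [ha]⟩, hpre⟩ fun y hy =>
    hmem y (by simp only [Finset.mem_filter] at hy; omega)
  have := hle hx
  simp only [Finset.mem_filter] at this
  omega

-- An initial segment keeps its positions; counting predecessors shows that they fit.
omit [DecidableEq A] in
theorem exists_restricted_order (hX : ∀ x ∈ X, ∀ y, ξ y < ξ x → y ∈ X) :
    ∃ ζ : {x // x ∈ X} ≃ Fin (Fintype.card {x // x ∈ X}), ∀ x, (ζ x : ℕ) = ξ x := by
  classical
  have hlt : ∀ x : {x // x ∈ X}, (ξ x : ℕ) < Fintype.card {x // x ∈ X} := by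
    rintro ⟨x, hx⟩
    rw [Fintype.card_coe, ← Finset.card_erase_add_one hx, Nat.lt_succ_iff]
    calc (ξ x : ℕ) = (Finset.range (ξ x)).card := (Finset.card_range _).symm
      _ ≤ ((X.erase x).image fun y => (ξ y : ℕ)).card := Finset.card_le_card fun i hi => ?_
      _ ≤ _ := Finset.card_image_le
    have hi' := Finset.mem_range.1 hi
    obtain ⟨y, rfl⟩ := exists_position ξ (hi'.trans (ξ x).2)
    refine Finset.mem_image.2 ⟨y, Finset.mem_erase.2 ⟨?_, hX x hx y hi'⟩, rfl⟩
    rintro rfl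
    exact lt_irrefl _ hi'
  refine ⟨Equiv.ofBijective (fun x => ⟨ξ x, hlt x⟩)
    ((Fintype.bijective_iff_injective_and_card _).2 ⟨fun x y hxy => ?_, by simp⟩), fun _ => rfl⟩
  exact Subtype.ext (ξ.injective (Fin.ext (Fin.mk.inj hxy)))

/-- The projection commutes with the restriction to a unanimously preferred set whose pairs all
have full turnout. -/
theorem UnanimouslyPreferred.isCLCProjection_restrict (hv : IsLlull v) (hξ : IsAdmissible v ξ)
    (hτ : IsProjTurnout v ξ τ) (hπ : IsProjScores ξ (cutMargin v ξ) (posMatrix ξ τ) π)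
    (hX : UnanimouslyPreferred v X) (hne : X.Nonempty)
    (ht : ∀ x ∈ X, ∀ y, x ≠ y → turnout v x y = 1) :
    IsCLCProjection (fun x y : {x // x ∈ X} => v x y) (fun x y => π x y) := by
  have hvX : IsLlull fun x y : {x // x ∈ X} => v x y := fun x y hxy =>
    hv x y (Subtype.coe_ne_coe.2 hxy)
  have hm := indirectMargin_restrict hv (hX.eq_zero hv)
  obtain ⟨ζ, hζ⟩ := exists_restricted_order (ξ := ξ) (X := X) fun x hx y hyx =>
    hX.mem_of_le hv hξ hx hyx.le
  have hadm : IsAdmissible (fun x y : {x // x ∈ X} => v x y) ζ := fun x y hxy => by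
    rw [hm]
    refine hξ x y (Fin.lt_def.2 ?_)
    rw [← hζ, ← hζ]
    exact hxy
  have hcard : Fintype.card {x // x ∈ X} ≤ Fintype.card A :=
    Fintype.card_le_of_injective _ Subtype.val_injective
  have hmem : ∀ k, k + 1 < Fintype.card {x // x ∈ X} → ∀ x, (ξ x : ℕ) ≤ k + 1 → x ∈ X := by
    intro k hk x hx
    obtain ⟨z, hz⟩ := exists_position ζ hk
    exact hX.mem_of_le hv hξ z.2 (Fin.le_def.2 (by rw [← hζ, hz]; exact hx))
  have hcut : ∀ k, k + 1 < Fintype.card {x // x ∈ X} →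
      cutMargin (fun x y : {x // x ∈ X} => v x y) ζ k = cutMargin v ξ k := by
    intro k hk
    refine eq_of_forall_le_iff fun c => ?_
    rw [le_cutMargin_iff hk, le_cutMargin_iff (by omega)]
    refine ⟨fun h p q hp hq => ?_, fun h p q hp hq => ?_⟩
    · have hpX := hmem k hk p (by omega)
      by_cases hqX : q ∈ X
      · have := h ⟨p, hpX⟩ ⟨q, hqX⟩ (by rwa [hζ]) (by rwa [hζ])
        rwa [hm] at this
      -- A pair leaving `X` has the largest possible margin, so it does not lower the minimum. The
      -- option `z` at position `k + 1` gives a pair inside `X` to compare with.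
      · rw [hX.indirectMargin_eq_one hv hpX hqX]
        obtain ⟨z, hz⟩ := exists_position ζ hk
        refine (h ⟨p, hpX⟩ z (by rwa [hζ]) (by omega)).trans (indirectMargin_le_one hvX ?_)
        refine (position_ne (ξ := ζ)).1 ?_
        rw [hζ, hz]
        show (ξ p : ℕ) ≠ k + 1
        omega
    · rw [hm]
      exact h p q (by rwa [← hζ]) (by rwa [← hζ])
  -- All turnouts inside `X` equal one, so the constant one has deviation zero.
  have hτX : IsProjTurnout (fun x y : {x // x ∈ X} => v x y) ζ fun _ _ => 1 := by
    refine ⟨isFeasible_const hadm le_rfl fun _ hk => cutMargin_le_one hvX hk, fun τ' _ => ?_⟩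
    refine le_trans (le_of_eq ?_) (deviation_nonneg _ τ')
    refine Finset.sum_eq_zero fun x _ => Finset.sum_eq_zero fun y hy => ?_
    have := ht x x.2 y (Subtype.coe_ne_coe.2 (Finset.ne_of_mem_erase hy).symm)
    unfold turnout at this ⊢
    rw [this]
    norm_num
  refine isCLCProjection_iff.2 ⟨ζ, hadm, _, hτX, ?_⟩
  refine (isProjScores_congr (M' := cutMargin v ξ) (T' := posMatrix ξ τ) hcut fun k hk => ?_).2 ?_
  · rw [hX.posMatrix_eq_one hv hξ hτ hne ht (by omega) (hmem k hk)]
    obtain ⟨a, ha⟩ := exists_position ζ (show k < Fintype.card {x // x ∈ X} by omega)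
    obtain ⟨b, hb⟩ := exists_position ζ hk
    rw [← hb, ← ha, posMatrix_apply]
  · intro x y hxy
    rw [hζ, hζ]
    refine hπ x y (Fin.lt_def.2 ?_)
    rw [← hζ, ← hζ]
    exact hxy

end Preferred

/-! ### The three properties for a Llull matrix -/

section Rates

variable {A : Type*} [Fintype A] [DecidableEq A] [Nonempty A] {v : A → A → ℝ} {φ : A → ℝ}

theorem IsFractionRates.unique {ψ : A → ℝ} (h : IsFractionRates v φ)
    (h' : IsFractionRates v ψ) : φ = ψ := by
  obtain ⟨π, hπ, hφ⟩ := h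
  obtain ⟨π', hπ', hψ⟩ := h'
  rw [← isStrengths_congr fun x y hxy => hπ.unique hπ' hxy] at hψ
  exact hφ.unique (fun x y hxy => hπ.nonneg hxy) hψ

theorem IsFractionRates.sum_eq_one (h : IsFractionRates v φ) : ∑ x, φ x = 1 := by
  obtain ⟨π, hπ, hφ⟩ := h
  exact hφ.sum_eq_one fun x y hxy => hπ.nonneg hxy

theorem exists_isFractionRates (hv : IsLlull v)
    (hne : Subsingleton A ∨ ∃ x y, x ≠ y ∧ v x y ≠ 0) : ∃ φ, IsFractionRates v φ := by
  obtain ⟨π, hπ⟩ := exists_isCLCProjection hv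
  obtain ⟨ξ, hξ, τ, hτ, hsc⟩ := isCLCProjection_iff.1 hπ
  obtain ⟨φ, -, -, hφ, -⟩ := exists_isStrengths_of_isProjScores hv hne hξ hτ hsc rfl
  exact ⟨φ, π, hπ, hφ⟩

theorem IsFractionRates.eq_zero (hv : IsLlull v)
    (hne : Subsingleton A ∨ ∃ x y, x ≠ y ∧ v x y ≠ 0) (h : IsFractionRates v φ) {X : Finset A}
    (hXne : X.Nonempty) (hX : UnanimouslyPreferred v X) {y : A} (hy : y ∉ X) : φ y = 0 := by
  obtain ⟨π, hπ, hφ⟩ := h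
  obtain ⟨ξ, hξ, τ, hτ, hsc⟩ := isCLCProjection_iff.1 hπ
  obtain ⟨ψ, -, hψ0, hψ, -⟩ := exists_isStrengths_of_isProjScores hv hne hξ hτ hsc rfl
  rw [hφ.unique (fun x y hxy => hπ.nonneg hxy) hψ]
  exact hψ0 y fun hmem =>
    hy (hX.topClass_subset hv hξ ((isFeasible_iff hξ).1 hτ.1).2 hXne hmem)

theorem IsFractionRates.restrict (hv : IsLlull v)
    (hne : Subsingleton A ∨ ∃ x y, x ≠ y ∧ v x y ≠ 0) (h : IsFractionRates v φ) {X : Finset A}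
    (hX : IsMinimalPreferred v X) (ht : ∀ x ∈ X, ∀ y, x ≠ y → turnout v x y = 1) :
    (∀ x ∈ X, 0 < φ x) ∧
      IsFractionRates (fun x y : {x // x ∈ X} => v x y) (fun x => φ x) := by
  obtain ⟨π, hπ, hφ⟩ := h
  obtain ⟨ξ, hξ, τ, hτ, hsc⟩ := isCLCProjection_iff.1 hπ
  obtain ⟨ψ, hψ1, -, hψ, hψX⟩ := exists_isStrengths_of_isProjScores hv hne hξ hτ hsc
    (hX.eq_topClass hv hξ hτ ht)
  rw [hφ.unique (fun x y hxy => hπ.nonneg hxy) hψ]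
  exact ⟨hψ1, _, hX.prop.2.isCLCProjection_restrict hv hξ hτ hsc hX.prop.1 ht, hψX⟩

/-- Take a minimal preferred set `Z`. It carries the whole mass one with positive rates and contains
`X`, which also carries mass one; hence `X` is all of `Z`. -/
theorem IsFractionRates.isMinimalPreferred (hv : IsLlull v)
    (hne : Subsingleton A ∨ ∃ x y, x ≠ y ∧ v x y ≠ 0) (ht : ∀ x y, x ≠ y → turnout v x y = 1)
    (h : IsFractionRates v φ) {X : Finset A} (hXne : X.Nonempty) (hpos : ∀ x ∈ X, 0 < φ x)
    (hX : IsFractionRates (fun x y : {x // x ∈ X} => v x y) (fun x => φ x)) :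
    IsMinimalPreferred v X := by
  have : Nonempty {x // x ∈ X} := hXne.to_subtype
  obtain ⟨Z, hZ⟩ := exists_minimal_of_wellFoundedLT
    (fun Y : Finset A => Y.Nonempty ∧ UnanimouslyPreferred v Y)
    ⟨Finset.univ, Finset.univ_nonempty, fun x _ y hy => absurd (Finset.mem_univ y) hy⟩
  have hZpos := (h.restrict hv hne hZ fun x _ y hxy => ht x y hxy).1
  have hsub : X ⊆ Z := fun x hx => by
    by_contra hxZ
    exact (hpos x hx).ne' (h.eq_zero hv hne hZ.prop.1 hZ.prop.2 hxZ)
  have hsum : ∑ x ∈ Z, φ x = ∑ x ∈ X, φ x := by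
    rw [← Finset.sum_coe_sort X, hX.sum_eq_one, ← h.sum_eq_one]
    exact Finset.sum_subset (Finset.subset_univ _) fun y _ hy =>
      h.eq_zero hv hne hZ.prop.1 hZ.prop.2 hy
  have hXZ : X = Z := by
    by_contra hXZ
    obtain ⟨z, hz, hzX⟩ := Finset.exists_of_ssubset (hsub.ssubset_of_ne hXZ)
    have := Finset.sum_lt_sum_of_subset hsub hz hzX (hZpos z hz) fun x hx _ => (hZpos x hx).le
    linarith
  rw [hXZ]
  exact hZ

end Rates

/-! ### From individual votes to their Llull matrix -/

section Votes

variable {A ι : Type*} [Fintype ι] {w : ι → ℝ} {u : ι → A → A → ℝ}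

theorem isLlull_llull (hw : ∀ i, 0 < w i) (hsum : ∑ i, w i = 1) (hu : ∀ i, IsLlull (u i)) :
    IsLlull (llull w u) := by
  intro x y hxy
  unfold llull
  rw [← Finset.sum_add_distrib, ← hsum]
  refine ⟨Finset.sum_nonneg fun i _ => mul_nonneg (hw i).le (hu i x y hxy).1,
    Finset.sum_le_sum fun i _ => mul_le_of_le_one_right (hw i).le (hu i x y hxy).2.1,
    Finset.sum_le_sum fun i _ => ?_⟩
  rw [← mul_add]
  exact mul_le_of_le_one_right (hw i).le (hu i x y hxy).2.2

theorem turnout_llull_eq_one (hsum : ∑ i, w i = 1) {x y : A}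
    (h : ∀ i, u i x y + u i y x = 1) : turnout (llull w u) x y = 1 := by
  unfold turnout llull
  rw [← Finset.sum_add_distrib, ← hsum]
  exact Finset.sum_congr rfl fun i _ => by rw [← mul_add, h, mul_one]

/-- A weighted mean with positive weights of numbers at most one equals one only if each of them
does. -/
theorem eq_one_of_llull_eq_one (hw : ∀ i, 0 < w i) (hsum : ∑ i, w i = 1)
    (hu : ∀ i, IsLlull (u i)) {x y : A} (hxy : x ≠ y) (h : llull w u x y = 1) (i : ι) :
    u i x y = 1 := by
  have h0 : ∑ i, w i * (1 - u i x y) = 0 := by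
    simp_rw [mul_sub, mul_one, Finset.sum_sub_distrib, hsum]
    rw [show ∑ i, w i * u i x y = 1 from h, sub_self]
  have h1 := (Finset.sum_eq_zero_iff_of_nonneg fun i _ => mul_nonneg (hw i).le
    (sub_nonneg.2 (hu i x y hxy).2.1)).1 h0 i (Finset.mem_univ i)
  have h2 := (mul_eq_zero.1 h1).resolve_left (hw i).ne'
  linarith

/-- An option that is preferred to some other option in a ranking is mentioned, hence it is
compared with every other option. -/
theorem IsRanking.add_eq_one {u : A → A → ℝ} (hu : IsRanking u) {x y : A} (hxy : x ≠ y)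
    (h : u x y = 1) {z : A} (hxz : x ≠ z) : u x z + u z x = 1 := by
  obtain ⟨r, hr⟩ := hu
  have hx : r x ≠ ⊤ := by
    intro hx
    obtain ⟨-, h2, -, h4⟩ := hr x y hxy
    by_cases hy : r y = ⊤
    · rw [h4 hx hy] at h
      exact zero_ne_one h
    · rw [h2 (hx ▸ lt_top_iff_ne_top.2 hy)] at h
      exact zero_ne_one h
  obtain ⟨h1, h2, h3, -⟩ := hr x z hxz
  obtain ⟨g1, g2, g3, -⟩ := hr z x hxz.symm
  rcases lt_trichotomy (r x) (r z) with hlt | heq | hlt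
  · rw [h1 hlt, g2 hlt, add_zero]
  · rw [h3 heq hx, g3 heq.symm (heq ▸ hx)]
    norm_num
  · rw [h2 hlt, g1 hlt, zero_add]

end Votes

end FractionRates

open FractionRates

theorem mainTheorem1 {A : Type*} [Fintype A] [DecidableEq A] [Nonempty A]
    {ι : Type*} [Fintype ι] (w : ι → ℝ) (u : ι → A → A → ℝ)
    (hw : ∀ i, 0 < w i) (hsum : ∑ i, w i = 1)
    (hu : ∀ i, IsLlull (u i))
    (hv : Subsingleton A ∨ ∃ x y, x ≠ y ∧ llull w u x y ≠ 0) :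
    (∃! φ, IsFractionRates (llull w u) φ) ∧
    ∀ φ, IsFractionRates (llull w u) φ →
      (∀ X : Finset A, X.Nonempty →
        UnanimouslyPreferred (llull w u) X →
        ∀ y, y ∉ X → φ y = 0) ∧
      (((∀ i, IsCompleteVote (u i)) →
          ∀ X : Finset A, IsMinimalPreferred (llull w u) X →
            (∀ x ∈ X, 0 < φ x) ∧
            IsFractionRates
              (llull w (restrictVotes u X)) (fun x => φ x)) ∧
        ((∀ i, IsRanking (u i)) →
          ∀ X : Finset A, X ≠ Finset.univ →
            IsMinimalPreferred (llull w u) X →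
            (∀ x ∈ X, 0 < φ x) ∧
            IsFractionRates
              (llull w (restrictVotes u X)) (fun x => φ x))) ∧
      ((∀ i, IsCompleteVote (u i)) →
        ∀ X : Finset A, X.Nonempty →
          (∀ x ∈ X, 0 < φ x) →
          IsFractionRates
            (llull w (restrictVotes u X)) (fun x => φ x) →
          IsMinimalPreferred (llull w u) X) := by
  have hL := isLlull_llull hw hsum hu
  refine ⟨?_, fun φ hφ => ⟨fun X hne hX y hy => hφ.eq_zero hL hv hne hX hy,
    ⟨fun hc X hX => hφ.restrict hL hv hX fun x _ y hxy =>
      turnout_llull_eq_one hsum fun i => hc i x y hxy, fun hr X hun hX => ?_⟩,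
    fun hc X hne hpos hX => hφ.isMinimalPreferred hL hv
      (fun x y hxy => turnout_llull_eq_one hsum fun i => hc i x y hxy) hne hpos hX⟩⟩
  · obtain ⟨φ, hφ⟩ := exists_isFractionRates hL hv
    exact ⟨φ, hφ, fun ψ hψ => hψ.unique hφ⟩
  · obtain ⟨y, hy⟩ : ∃ y, y ∉ X := by
      by_contra! h
      exact hun (Finset.eq_univ_iff_forall.2 h)
    -- Every voter prefers each `x` in `X` to the outside option `y` and therefore mentions `x`, so
    -- all pairs containing `x` have full turnout.
    refine hφ.restrict hL hv hX fun x hx z hxz => turnout_llull_eq_one hsum fun i => ?_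
    have hxy : x ≠ y := ne_of_mem_of_not_mem hx hy
    exact (hr i).add_eq_one hxy
      (eq_one_of_llull_eq_one hw hsum hu hxy (hX.prop.2 x hx y hy) i) hxz
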